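/- Fix a constant $\nu>0$. There are a deterministic distributed algorithm $\mathcal A$, a constant $C$ (both depending only on $\nu$) and a function $g:\mathbb N\to\mathbb N$ with $g(\Delta)\le\Delta+1$ for all $\Delta$ and $g(\Delta)=o(\Delta)$ as $\Delta\to\infty$, such that the following holds. Let $G$ be any finite simple graph with $n$ vertices, maximum degree $\Delta$ and arboricity $a$ (the least number of edge-disjoint forests that cover the edges of $G$), with $a\le\Delta^{1-\nu}$, and let the vertices have arbitrary distinct identity numbers from $\{1,\dots,n\}$. Then $\mathcal A$, executed on $G$, computes a legal coloring of $G$ with colors from a palette of $g(\Delta)$ colors within at most $C\,(1+\log_2 a)(1+\log_2 n)$ rounds (where $\log_2 0$ is read as $0$). In particular, a $(\Delta+1)$-coloring, and indeed an $o(\Delta)$-coloring, is computed deterministically in $O(\log a\cdot\log n)$ time when $a,n\ge 2$. Here a distributed algorithm runs in the synchronous message passing model: each vertex hosts a processor that initially knows only its own identity number; all processors run the same algorithm; in each round every vertex sends a message of arbitrary size to each of its neighbors, receives the messages of its neighbors, and performs an arbitrary local computation; at some point each vertex irrevocably outputs its color. The running time is the number of rounds until every vertex has produced its output. -/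

import Mathlib

open Filter Asymptotics

/-- `G.IsForestDecomposition F`: the forests `F 0, …, F (k - 1)` are pairwise edge-disjoint and
their edges are exactly the edges of `G`. -/
def SimpleGraph.IsForestDecomposition {V : Type*} (G : SimpleGraph V) {k : ℕ}
    (F : Fin k → SimpleGraph V) : Prop :=
  (∀ i, (F i).IsAcyclic) ∧
    (∀ i j, i ≠ j → Disjoint (F i).edgeSet (F j).edgeSet) ∧
    (⋃ i, (F i).edgeSet) = G.edgeSet

/-- The arboricity of `G`: the least number of edge-disjoint forests covering the edges of `G`. -/
noncomputable def SimpleGraph.arboricity {V : Type*} (G : SimpleGraph V) : ℕ :=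
  sInf {k : ℕ | ∃ F : Fin k → SimpleGraph V, G.IsForestDecomposition F}

/-- On a finite graph the minimum defining the arboricity is over a nonempty set. -/
theorem SimpleGraph.exists_isForestDecomposition {V : Type*} [Finite V] (G : SimpleGraph V) :
    ∃ (k : ℕ) (F : Fin k → SimpleGraph V), G.IsForestDecomposition F := by
  classical
  obtain ⟨k, ⟨e⟩⟩ := Finite.exists_equiv_fin G.edgeSet
  have hE : ∀ i, (SimpleGraph.fromEdgeSet {(e.symm i : Sym2 V)}).edgeSet
      = {(e.symm i : Sym2 V)} := by
    intro i
    rw [SimpleGraph.edgeSet_fromEdgeSet]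
    ext x
    simp only [Set.mem_sdiff, Set.mem_singleton_iff]
    constructor
    · exact fun h => h.1
    · rintro rfl
      exact ⟨rfl, G.not_isDiag_of_mem_edgeSet (e.symm i).2⟩
  refine ⟨k, fun i => SimpleGraph.fromEdgeSet {(e.symm i : Sym2 V)}, ?_, ?_, ?_⟩
  · intro i v c hc
    have h3 := hc.three_le_length
    have hnd := hc.edges_nodup
    have hsub : c.edges.toFinset ⊆ {(e.symm i : Sym2 V)} := by
      intro x hx
      have hx' := c.edges_subset_edgeSet (List.mem_toFinset.1 hx)
      rw [hE] at hx'
      simpa using hx'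
    have hcard := Finset.card_le_card hsub
    rw [List.toFinset_card_of_nodup hnd, SimpleGraph.Walk.length_edges] at hcard
    simp at hcard
    omega
  · intro i j hij
    simp only [hE, Set.disjoint_singleton]
    intro h
    exact hij (e.symm.injective (Subtype.ext h))
  · ext x
    simp only [hE, Set.mem_iUnion, Set.mem_singleton_iff]
    constructor
    · rintro ⟨i, rfl⟩
      exact (e.symm i).2
    · intro hx
      exact ⟨e ⟨x, hx⟩, by simp⟩

/-- A deterministic algorithm in the synchronous message passing model. All vertices execute the
same algorithm, and a vertex initially knows nothing but its own identity number. Message size and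
local computation are unbounded; only rounds of communication are counted. -/
structure LocalAlgorithm where
  /-- internal states of a processor -/
  State : Type
  /-- messages -/
  Message : Type
  /-- the initial state of the vertex with the given identity number -/
  init : ℕ → State
  /-- `send s j` is the message that a vertex in state `s` sends to its neighbor (if there is one)
  whose identity number is `j` -/
  send : State → ℕ → Message
  /-- the new state, from the old one and the messages received in this round, indexed by the
  identity numbers of their senders (`none` where no neighbor has that identity number) -/
  receive : State → (ℕ → Option Message) → State
  /-- the output of a vertex in a given state, `none` as long as it has not decided -/
  output : State → Option ℕ
  /-- outputs are irrevocable -/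
  output_final : ∀ (s : State) (m : ℕ → Option Message) (c : ℕ),
    output s = some c → output (receive s m) = some c

/-- Identity numbers: distinct vertices get distinct numbers from `{1, …, n}`, where `n` is the
number of vertices. -/
def IsIdentityAssignment {V : Type*} [Fintype V] (ident : V → ℕ) : Prop :=
  Function.Injective ident ∧ ∀ v, 1 ≤ ident v ∧ ident v ≤ Fintype.card V

namespace LocalAlgorithm

variable {V : Type*}

open Classical in
/-- The messages that reach `v` in a round that the vertices enter with the states `s`. -/
noncomputable def inbox (A : LocalAlgorithm) (G : SimpleGraph V) (ident : V → ℕ)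
    (s : V → A.State) (v : V) : ℕ → Option A.Message := fun j =>
  if h : ∃ u, G.Adj v u ∧ ident u = j then some (A.send (s h.choose) (ident v)) else none

/-- The state of each vertex after `t` rounds of the execution on the network `G`. -/
noncomputable def stateAfter (A : LocalAlgorithm) (G : SimpleGraph V) (ident : V → ℕ) :
    ℕ → V → A.State
  | 0 => fun v => A.init (ident v)
  | t + 1 => fun v =>
      A.receive (A.stateAfter G ident t v) (A.inbox G ident (A.stateAfter G ident t) v)

/-- After `T` rounds every vertex has decided on a color from a palette of `k` colors
(`0, …, k - 1`), and these colors form a legal coloring of `G`. -/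
def ColorsWithin (A : LocalAlgorithm) (G : SimpleGraph V) (ident : V → ℕ) (T k : ℕ) : Prop :=
  ∃ φ : G.Coloring (Fin k), ∀ v, A.output (A.stateAfter G ident T v) = some (φ v : ℕ)

end LocalAlgorithm

/-! Rounds are counted through locality. In the full-information algorithm each vertex gathers its
view and outputs as soon as the view forces its color, so it suffices to define a color function on
networks whose value at each vertex is fixed by the view of radius `O(log a * log n)`. The
definition itself must not mention `n`, `a` or `Δ`, which no vertex knows.

Arboricity enters only through sparsity: orienting forests towards roots gives out-degree at most
`a`, so every vertex set `S` spans at most `a * #S` edges. If `D` bounds this density, repeatedly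
removing the vertices with at most `4 * D` surviving neighbors ends after `O(log n)` rounds, because
the ball around a survivor doubles in each round (`two_pow_le_card_ball`). The removal rounds give
an orientation with at most `4 * D` out-neighbors per vertex.

The core is an arbdefective splitting (`sparse_restrict_split`): in `O(log n)` rounds the vertices
are divided into `k` classes of sparsity `2 * (4 * D / k)`. They choose in decreasing order of
removal level, refined by a defective coloring with constantly many colors, and each takes the class
least used among its predecessors. With `k = 2 ^ (b + 3)` the sparsity bound falls from `2 ^ (b * (s
+ 1)) - 1` to `2 ^ (b * s) - 1`. About `log a / b` iterations leave no edges and cost roughly `a ^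
(1 + 3 / b)` colors; for large `b` this is `o(Δ)`, since `a ≤ Δ ^ (1 - ν)`.

Since `a` is unknown, every vertex takes the least threshold that passes a locally verifiable
peeling test; vertices with different guesses use disjoint palettes. Finally, the palette can reach
`Δ + 1` only for finitely many `Δ`, hence only at bounded size, so reducing colors below a constant
greedily achieves `Δ + 1` at constant extra cost. -/

/-! ### Networks, views and locality. -/

/-- A locally finite network whose vertices are identified with their identity numbers. -/
structure Net where
  /-- the neighbors of a vertex -/
  nbr : ℕ → Finset ℕ
  symm : ∀ {u v}, u ∈ nbr v → v ∈ nbr u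
  irrefl : ∀ v, v ∉ nbr v

namespace Net

/-- The views of radius `t` around `v` in the two networks coincide. -/
def Agree : ℕ → Net → Net → ℕ → Prop
  | 0, _, _, _ => True
  | t + 1, N, N', v => N.nbr v = N'.nbr v ∧ ∀ u ∈ N.nbr v, Agree t N N' u

theorem Agree.of_succ {t : ℕ} {N N' : Net} {v : ℕ} (h : Agree (t + 1) N N' v) :
    Agree t N N' v := by
  induction t generalizing v with
  | zero => trivial
  | succ t ih => exact ⟨h.1, fun u hu => ih (h.2 u hu)⟩

theorem Agree.mono {t t' : ℕ} (htt : t ≤ t') {N N' : Net} {v : ℕ} (h : Agree t' N N' v) :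
    Agree t N N' v := by
  induction htt with
  | refl => exact h
  | step _ ih => exact ih h.of_succ

theorem Agree.refl (t : ℕ) (N : Net) (v : ℕ) : Agree t N N v := by
  induction t generalizing v with
  | zero => trivial
  | succ t ih => exact ⟨rfl, fun u _ => ih u⟩

/-- In the network `N`, the value of `f` at a vertex `v < n` is determined by its view of
radius `t`. -/
def Det {X : Type*} (N : Net) (n t : ℕ) (f : Net → ℕ → X) : Prop :=
  ∀ N' v, v < n → Agree t N N' v → f N v = f N' v

theorem Det.mono {X : Type*} {N : Net} {n t t' : ℕ} {f : Net → ℕ → X} (h : Det N n t f)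
    (htt : t ≤ t') : Det N n t' f :=
  fun N' v hv h' => h N' v hv (h'.mono htt)

theorem det_nbr (N : Net) (n : ℕ) : Det N n 1 Net.nbr := fun _ _ _ h => h.1

end Net

/-! ### The full-information algorithm. -/

namespace LocalAlgorithm

open Classical in
/-- The common value of `φ` at vertex `s.1` on the networks of `s.2`, if there is one. -/
noncomputable def commonValue (φ : Net → ℕ → ℕ) (s : ℕ × Set Net) : Option ℕ :=
  if h : s.2.Nonempty ∧ ∃ c, ∀ N ∈ s.2, φ N s.1 = c then some h.2.choose else none

theorem commonValue_eq_some_iff {φ : Net → ℕ → ℕ} {s : ℕ × Set Net} {c : ℕ} :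
    commonValue φ s = some c ↔ s.2.Nonempty ∧ ∀ N ∈ s.2, φ N s.1 = c := by
  unfold commonValue
  constructor
  · intro h
    split_ifs at h with hd
    refine ⟨hd.1, fun N hN => ?_⟩
    rw [← Option.some.inj h]
    exact hd.2.choose_spec N hN
  · rintro ⟨hne, hc⟩
    have hd : s.2.Nonempty ∧ ∃ c, ∀ N ∈ s.2, φ N s.1 = c := ⟨hne, c, hc⟩
    rw [dif_pos hd]
    congr 1
    obtain ⟨N, hN⟩ := hne
    rw [← hd.2.choose_spec N hN, hc N hN]

/-- The networks of `s.2` that are consistent with the messages `m` received by `s.1`. -/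
def consistent (s : ℕ × Set Net) (m : ℕ → Option (Set Net)) : Set Net :=
  s.2 ∩ {N | (∀ j, j ∈ N.nbr s.1 ↔ (m j).isSome) ∧ ∀ j M, m j = some M → N ∈ M}

open Classical in
/-- The algorithm in which every vertex collects its view, represented as the set of all networks
consistent with it, and outputs its value of `φ` as soon as that is determined by the view. -/
noncomputable def ofDetermined (φ : Net → ℕ → ℕ) : LocalAlgorithm where
  State := ℕ × Set Net
  Message := Set Net
  init i := (i, Set.univ)
  send s _ := s.2
  -- Irrevocability is demanded for arbitrary messages, even ones no execution produces; keeping the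
  -- old state on contradictory input prevents a decision from being lost.
  receive s m := if (consistent s m).Nonempty then (s.1, consistent s m) else s
  output := commonValue φ
  output_final := by
    intro s m c hc
    split_ifs with hne
    · rw [commonValue_eq_some_iff] at hc ⊢
      exact ⟨hne, fun N hN => hc.2 N hN.1⟩
    · exact hc

variable {V : Type*} [Fintype V]

open Classical in
/-- The network of identity numbers of a graph. -/
noncomputable def _root_.Net.ofGraph (G : SimpleGraph V) (ident : V → ℕ)
    (hid : Function.Injective ident) : Net where
  nbr j := (Finset.univ.filter fun u => ∃ v, ident v = j ∧ G.Adj v u).image ident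
  symm := by
    intro i j h
    simp only [Finset.mem_image, Finset.mem_filter, Finset.mem_univ, true_and] at h ⊢
    obtain ⟨u, ⟨v, rfl, h⟩, rfl⟩ := h
    exact ⟨v, ⟨u, rfl, h.symm⟩, rfl⟩
  irrefl := by
    intro j h
    simp only [Finset.mem_image, Finset.mem_filter, Finset.mem_univ, true_and] at h
    obtain ⟨u, ⟨v, rfl, h⟩, h'⟩ := h
    exact G.ne_of_adj h (hid h').symm

theorem _root_.Net.mem_nbr_ofGraph {G : SimpleGraph V} {ident : V → ℕ}
    {hid : Function.Injective ident} {i j : ℕ} :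
    i ∈ (Net.ofGraph G ident hid).nbr j ↔ ∃ u v, ident u = i ∧ ident v = j ∧ G.Adj v u := by
  simp only [Net.ofGraph, Finset.mem_image, Finset.mem_filter, Finset.mem_univ, true_and]
  constructor
  · rintro ⟨u, ⟨v, rfl, h⟩, rfl⟩
    exact ⟨u, v, rfl, rfl, h⟩
  · rintro ⟨u, v, rfl, rfl, h⟩
    exact ⟨u, ⟨v, rfl, h⟩, rfl⟩

theorem _root_.Net.ident_mem_nbr_ofGraph {G : SimpleGraph V} {ident : V → ℕ}
    {hid : Function.Injective ident} {u v : V} :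
    ident u ∈ (Net.ofGraph G ident hid).nbr (ident v) ↔ G.Adj v u := by
  rw [Net.mem_nbr_ofGraph]
  constructor
  · rintro ⟨u', v', hu, hv, h⟩
    rwa [← hid hu, ← hid hv]
  · exact fun h => ⟨u, v, rfl, rfl, h⟩

/-- The invariant of the execution: the true network is never excluded, and every network not yet
excluded has the same view of radius `t`. Hence a value determined by that view is common to all
remaining candidates. -/
theorem stateAfter_ofDetermined (φ : Net → ℕ → ℕ) (G : SimpleGraph V) (ident : V → ℕ)
    (hid : Function.Injective ident) (t : ℕ) (v : V) :
    ∃ S : Set Net, (ofDetermined φ).stateAfter G ident t v = (ident v, S) ∧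
      Net.ofGraph G ident hid ∈ S ∧
      ∀ N ∈ S, Net.Agree t (Net.ofGraph G ident hid) N (ident v) := by
  induction t generalizing v with
  | zero => exact ⟨Set.univ, rfl, trivial, fun _ _ => trivial⟩
  | succ t ih =>
    choose S hS hmem hag using ih
    obtain ⟨m, hm⟩ : ∃ m : ℕ → Option (Set Net),
        m = (ofDetermined φ).inbox G ident ((ofDetermined φ).stateAfter G ident t) v := ⟨_, rfl⟩
    have hm1 : ∀ u, G.Adj v u → m (ident u) = some (S u) := by
      intro u hu
      have h : ∃ u', G.Adj v u' ∧ ident u' = ident u := ⟨u, hu, rfl⟩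
      rw [hm, inbox, dif_pos h]
      have : h.choose = u := hid h.choose_spec.2
      rw [this, hS]
      rfl
    have hm2 : ∀ j (M : Set Net), m j = some M → ∃ u, G.Adj v u ∧ ident u = j ∧ M = S u := by
      intro j M hj
      by_cases h : ∃ u', G.Adj v u' ∧ ident u' = j
      · obtain ⟨u, hu, rfl⟩ := h
        rw [hm1 u hu] at hj
        exact ⟨u, hu, rfl, (Option.some.inj hj).symm⟩
      · rw [hm, inbox, dif_neg h] at hj
        cases hj
    have hsome : ∀ j, j ∈ (Net.ofGraph G ident hid).nbr (ident v) ↔ (m j).isSome := by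
      intro j
      constructor
      · intro hj
        obtain ⟨u, v', rfl, hv', h⟩ := Net.mem_nbr_ofGraph.1 hj
        obtain rfl := hid hv'
        rw [hm1 u h]
        rfl
      · intro hj
        obtain ⟨M, hM⟩ := Option.isSome_iff_exists.1 hj
        obtain ⟨u, hu, rfl, -⟩ := hm2 j M hM
        exact Net.ident_mem_nbr_ofGraph.2 hu
    have hin : Net.ofGraph G ident hid ∈ consistent (ident v, S v) m := by
      refine ⟨hmem v, hsome, fun j M hj => ?_⟩
      obtain ⟨u, hu, rfl, rfl⟩ := hm2 j M hj
      exact hmem u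
    refine ⟨consistent (ident v, S v) m, ?_, hin, ?_⟩
    · change (ofDetermined φ).receive _ ((ofDetermined φ).inbox G ident _ v) = _
      rw [hS v, ← hm]
      exact if_pos ⟨_, hin⟩
    · rintro N ⟨-, hN1, hN2⟩
      refine ⟨?_, fun i hi => ?_⟩
      · ext j
        rw [hsome, hN1]
      · obtain ⟨M, hM⟩ := Option.isSome_iff_exists.1 ((hsome i).1 hi)
        obtain ⟨u, hu, rfl, rfl⟩ := hm2 i M hM
        exact hag u N (hN2 _ _ hM)

theorem output_ofDetermined (φ : Net → ℕ → ℕ) (G : SimpleGraph V) (ident : V → ℕ)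
    (hid : Function.Injective ident) (t : ℕ) {n : ℕ} (hn : ∀ v, ident v < n)
    (h : Net.Det (Net.ofGraph G ident hid) n t φ) (v : V) :
    (ofDetermined φ).output ((ofDetermined φ).stateAfter G ident t v)
      = some (φ (Net.ofGraph G ident hid) (ident v)) := by
  obtain ⟨S, hS, hmem, hag⟩ := stateAfter_ofDetermined φ G ident hid t v
  rw [hS]
  exact commonValue_eq_some_iff.2 ⟨⟨_, hmem⟩, fun N hN => (h N _ (hn v) (hag N hN)).symm⟩

end LocalAlgorithm

/-! ### Sparsity and peeling. -/

namespace Net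

open Finset

/-- Every set of vertices spans at most `D` times as many edges as it has elements. -/
def Sparse (nb : ℕ → Finset ℕ) (D : ℕ) : Prop :=
  ∀ S : Finset ℕ, ∑ u ∈ S, #(nb u ∩ S) ≤ 2 * D * #S

/-- The sum counts every edge inside `S` twice, and each edge can be charged to an endpoint having
it as an out-edge. Orienting an edge both ways is allowed, so ties need no breaking later. -/
theorem Sparse.of_orientation {nb out : ℕ → Finset ℕ} {D : ℕ}
    (h : ∀ v, ∀ u ∈ nb v, u ∈ out v ∨ v ∈ out u) (hD : ∀ v, #(out v) ≤ D) : Sparse nb D := by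
  intro S
  have h1 : ∀ T : Finset ℕ, #(T ∩ S) = ∑ w ∈ S, if w ∈ T then 1 else 0 := by
    intro T
    rw [← card_filter, inter_comm, filter_mem_eq_inter]
  calc ∑ u ∈ S, #(nb u ∩ S) = ∑ u ∈ S, ∑ w ∈ S, (if w ∈ nb u then 1 else 0) :=
        sum_congr rfl fun u _ => h1 _
    _ ≤ ∑ u ∈ S, ∑ w ∈ S, ((if w ∈ out u then 1 else 0) + (if u ∈ out w then 1 else 0)) := by
        refine sum_le_sum fun u _ => sum_le_sum fun w _ => ?_
        by_cases hw : w ∈ nb u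
        · rcases h u w hw with h' | h' <;> simp [hw, h']
        · simp [hw]
    _ = 2 * ∑ u ∈ S, ∑ w ∈ S, (if w ∈ out u then 1 else 0) := by
        simp_rw [sum_add_distrib]
        rw [sum_comm (f := fun u w => if u ∈ out w then 1 else 0), two_mul]
    _ = 2 * ∑ u ∈ S, #(out u ∩ S) := by
        rw [sum_congr rfl fun u _ => (h1 (out u)).symm]
    _ ≤ 2 * ∑ u ∈ S, D := by
        gcongr with u
        exact (card_le_card inter_subset_left).trans (hD u)
    _ = 2 * D * #S := by rw [sum_const, smul_eq_mul]; ring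

theorem Sparse.eq_empty {nb : ℕ → Finset ℕ} (h : Sparse nb 0) (v : ℕ) : nb v = ∅ := by
  by_contra hne
  obtain ⟨u, hu⟩ := nonempty_iff_ne_empty.2 hne
  have h1 := h {u, v}
  simp only [mul_zero, zero_mul, nonpos_iff_eq_zero, sum_eq_zero_iff, card_eq_zero] at h1
  have h2 := h1 v (by simp)
  have : u ∈ nb v ∩ {u, v} := by simp [hu]
  simp [h2] at this

/-- The ball of radius `r` around `v`. -/
def ball (nb : ℕ → Finset ℕ) : ℕ → ℕ → Finset ℕ
  | 0, v => {v}
  | r + 1, v => insert v ((nb v).biUnion (ball nb r))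

theorem self_mem_ball (nb : ℕ → Finset ℕ) (r v : ℕ) : v ∈ ball nb r v := by
  cases r <;> simp [ball]

theorem mem_ball_succ_of_mem {nb : ℕ → Finset ℕ} {r v u w : ℕ} (hu : u ∈ ball nb r v)
    (hw : w ∈ nb u) : w ∈ ball nb (r + 1) v := by
  induction r generalizing v with
  | zero =>
    obtain rfl : u = v := by simpa [ball] using hu
    rw [ball, mem_insert, mem_biUnion]
    exact Or.inr ⟨w, hw, self_mem_ball _ _ _⟩
  | succ r ih =>
    rw [ball, mem_insert, mem_biUnion] at hu ⊢
    rcases hu with rfl | ⟨x, hx, hu⟩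
    · exact Or.inr ⟨w, hw, self_mem_ball _ _ _⟩
    · exact Or.inr ⟨x, hx, ih hu⟩

theorem ball_subset_range {nb : ℕ → Finset ℕ} {n : ℕ} (hn : ∀ v, ∀ u ∈ nb v, u < n) (r : ℕ)
    {v : ℕ} (hv : v < n) : ball nb r v ⊆ range n := by
  induction r generalizing v with
  | zero => simpa [ball] using hv
  | succ r ih =>
    rw [ball, insert_subset_iff, biUnion_subset]
    exact ⟨mem_range.2 hv, fun u hu => ih (hn v u hu)⟩

theorem card_ball_le {nb : ℕ → Finset ℕ} {n : ℕ} (hn : ∀ v, ∀ u ∈ nb v, u < n)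
    (hempty : ∀ v, n ≤ v → nb v = ∅) (hpos : 0 < n) (r v : ℕ) : #(ball nb r v) ≤ n := by
  rcases lt_or_ge v n with hv | hv
  · simpa using card_le_card (ball_subset_range hn r hv)
  · have : ball nb r v = {v} := by cases r <;> simp [ball, hempty v hv]
    rw [this, card_singleton]
    exact hpos

open Classical in
/-- `Unpeeled nb A r v`: the vertex `v` survives `r` rounds, in each of which all vertices with at
most `A` surviving neighbors are removed. -/
def Unpeeled (nb : ℕ → Finset ℕ) (A : ℕ) : ℕ → ℕ → Prop
  | 0, _ => True
  | r + 1, v => A < #{u ∈ nb v | Unpeeled nb A r u}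

open Classical in
theorem Unpeeled.of_succ {nb : ℕ → Finset ℕ} {A r v : ℕ} (h : Unpeeled nb A (r + 1) v) :
    Unpeeled nb A r v := by
  induction r generalizing v with
  | zero => trivial
  | succ r ih =>
    rw [Unpeeled] at h ⊢
    refine h.trans_le (card_le_card ?_)
    intro u
    simp only [mem_filter]
    exact fun hu => ⟨hu.1, ih hu.2⟩

theorem Unpeeled.mono {nb : ℕ → Finset ℕ} {A r r' v : ℕ} (hr : r ≤ r')
    (h : Unpeeled nb A r' v) : Unpeeled nb A r v := by
  induction hr with
  | refl => exact h
  | step _ ih => exact ih h.of_succ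

-- Let `S` be the vertices within distance `j` that survive `r - j` rounds, and `T` the analogous
-- set for `j + 1`. Each vertex of `S` has more than `A ≥ 4 * D` neighbors in `T`, while `T` has
-- total internal degree at most `2 * D * #T`; so `#T ≥ 2 * #S`.
open Classical in
theorem two_pow_le_card_ball {nb : ℕ → Finset ℕ} {A D : ℕ} (hs : Sparse nb D) (hA : 4 * D ≤ A)
    {r v : ℕ} (h : Unpeeled nb A r v) : 2 ^ r ≤ #(ball nb r v) := by
  have key : ∀ j ≤ r, 2 ^ j ≤ #{u ∈ ball nb j v | Unpeeled nb A (r - j) u} := by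
    intro j hj
    induction j with
    | zero =>
      rw [pow_zero, Nat.one_le_iff_ne_zero, card_ne_zero]
      exact ⟨v, by simpa [ball] using h⟩
    | succ j ih =>
      specialize ih (by omega)
      set S := {u ∈ ball nb j v | Unpeeled nb A (r - j) u} with hS
      set T := {u ∈ ball nb (j + 1) v | Unpeeled nb A (r - (j + 1)) u} with hT
      have hrj : r - j = r - (j + 1) + 1 := by omega
      have hdeg : ∀ u ∈ S, A + 1 ≤ #(nb u ∩ T) := by
        intro u hu
        rw [hS, mem_filter, hrj, Unpeeled] at hu
        refine hu.2.trans_le (card_le_card ?_)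
        intro w hw
        rw [mem_filter] at hw
        rw [mem_inter, hT, mem_filter]
        exact ⟨hw.1, mem_ball_succ_of_mem hu.1 hw.1, hw.2⟩
      have hST : S ⊆ T := by
        intro u hu
        rw [hS, mem_filter] at hu
        rw [hT, mem_filter]
        refine ⟨?_, hu.2.mono (by omega)⟩
        have h2 : ∀ j v, u ∈ ball nb j v → u ∈ ball nb (j + 1) v := by
          intro j
          induction j with
          | zero =>
            intro v hu
            obtain rfl : u = v := by simpa [ball] using hu
            exact self_mem_ball _ _ _
          | succ j ihj =>
            intro v hu
            rw [ball, mem_insert, mem_biUnion] at hu ⊢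
            exact hu.imp id fun ⟨x, hx, hu⟩ => ⟨x, hx, ihj x hu⟩
        exact h2 j v hu.1
      have h1 : #S * (A + 1) ≤ 2 * D * #T := by
        calc #S * (A + 1) = ∑ u ∈ S, (A + 1) := by rw [sum_const, smul_eq_mul]
          _ ≤ ∑ u ∈ S, #(nb u ∩ T) := sum_le_sum hdeg
          _ ≤ ∑ u ∈ T, #(nb u ∩ T) := sum_le_sum_of_subset hST
          _ ≤ 2 * D * #T := hs T
      have hpos : 0 < 2 ^ j := by positivity
      have h3 : 2 * #S ≤ #T := by
        by_contra hlt
        push Not at hlt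
        have : 2 * D * #T ≤ 2 * D * (2 * #S) := Nat.mul_le_mul_left _ hlt.le
        have : #S * (4 * D + 1) ≤ #S * (A + 1) := Nat.mul_le_mul_left _ (by omega)
        nlinarith
      rw [pow_succ]
      omega
  refine (key r le_rfl).trans (card_le_card (filter_subset _ _))

/-- The round in which a vertex is removed. -/
noncomputable def level (nb : ℕ → Finset ℕ) (A v : ℕ) : ℕ := sInf {r | ¬ Unpeeled nb A r v}

theorem level_le {nb : ℕ → Finset ℕ} {A r v : ℕ} (h : ¬ Unpeeled nb A r v) :
    level nb A v ≤ r := Nat.sInf_le h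

theorem not_unpeeled_level {nb : ℕ → Finset ℕ} {A r v : ℕ} (h : ¬ Unpeeled nb A r v) :
    ¬ Unpeeled nb A (level nb A v) v :=
  Nat.sInf_mem (s := {r | ¬ Unpeeled nb A r v}) ⟨r, h⟩

theorem unpeeled_of_lt_level {nb : ℕ → Finset ℕ} {A r v : ℕ} (h : r < level nb A v) :
    Unpeeled nb A r v := by
  by_contra hr
  exact (level_le hr).not_gt h

/-- Neighbors of at least the same level were still present in the round that removed `v`, and
removal means there were at most `A` of them. -/
theorem card_level_le {nb : ℕ → Finset ℕ} {A r v : ℕ} (h : ¬ Unpeeled nb A r v) :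
    #{u ∈ nb v | level nb A v ≤ level nb A u} ≤ A := by
  classical
  have h1 := not_unpeeled_level h
  rcases hl : level nb A v with - | l
  · rw [hl] at h1
    exact absurd trivial h1
  · rw [hl, Unpeeled, not_lt] at h1
    refine (card_le_card ?_).trans h1
    intro u hu
    rw [mem_filter] at hu ⊢
    exact ⟨hu.1, unpeeled_of_lt_level hu.2⟩

/-! ### Averaging choices and polynomial codes. -/

theorem exists_argmin {q : ℕ} (hq : 0 < q) (w : ℕ → ℕ) : ∃ x < q, ∀ y < q, w x ≤ w y := by
  obtain ⟨x, hx, h⟩ := exists_min_image (range q) w ⟨0, mem_range.2 hq⟩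
  exact ⟨x, mem_range.1 hx, fun y hy => h y (mem_range.2 hy)⟩

open Classical in
/-- A minimizer of `w` on `{0, …, q - 1}`. -/
noncomputable def argmin (q : ℕ) (w : ℕ → ℕ) : ℕ :=
  if hq : 0 < q then (exists_argmin hq w).choose else 0

theorem argmin_lt {q : ℕ} (hq : 0 < q) (w : ℕ → ℕ) : argmin q w < q := by
  rw [argmin, dif_pos hq]
  exact (exists_argmin hq w).choose_spec.1

theorem mul_argmin_le {q : ℕ} (hq : 0 < q) (w : ℕ → ℕ) :
    q * w (argmin q w) ≤ ∑ x ∈ range q, w x := by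
  have h : ∀ x ∈ range q, w (argmin q w) ≤ w x := by
    intro x hx
    rw [argmin, dif_pos hq]
    exact (exists_argmin hq w).choose_spec.2 x (mem_range.1 hx)
  simpa using card_nsmul_le_sum _ _ _ h

-- Reed–Solomon codes: the numbers below `q ^ 8` name the polynomials of degree at most 7 over a
-- field with `q` elements, and the difference of two distinct ones has at most 7 roots.
open Polynomial in
theorem exists_code_of_field (F : Type*) [Field F] [Fintype F] :
    ∃ f : ℕ → ℕ → ℕ, (∀ c x, f c x < Fintype.card F) ∧
      ∀ c < Fintype.card F ^ 8, ∀ c' < Fintype.card F ^ 8, c ≠ c' →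
        #{x ∈ range (Fintype.card F) | f c x = f c' x} ≤ 7 := by
  classical
  set Q := Fintype.card F with hQ
  have hpos : 0 < Q := Fintype.card_pos
  let e : F ≃ Fin Q := Fintype.equivFin F
  let E : (Fin 8 → F) ≃ Fin (Q ^ 8) := Fintype.equivFinOfCardEq (by simp [hQ])
  let g : ℕ → (Fin 8 → F) := fun c => if h : c < Q ^ 8 then E.symm ⟨c, h⟩ else 0
  let p : ℕ → F[X] := fun c => ∑ i : Fin 8, C (g c i) * X ^ (i : ℕ)
  let y : ℕ → F := fun x => if h : x < Q then e.symm ⟨x, h⟩ else 0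
  refine ⟨fun c x => e ((p c).eval (y x)), fun c x => (e _).2, ?_⟩
  intro c hc c' hc' hne
  have hcoeff : ∀ c (i : Fin 8), (p c).coeff i = g c i := by
    intro c i
    simp [p, coeff_X_pow, Fin.val_inj]
  have hp : p c - p c' ≠ 0 := by
    intro h0
    apply hne
    have hg : g c = g c' := by
      funext i
      rw [← hcoeff, ← hcoeff, sub_eq_zero.1 h0]
    simp only [g, dif_pos hc, dif_pos hc'] at hg
    simpa using E.symm.injective hg
  have hdeg : (p c - p c').natDegree ≤ 7 := by
    have : ∀ c, (p c).natDegree ≤ 7 := by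
      intro c
      refine natDegree_sum_le_of_forall_le _ _ fun i _ => ?_
      refine (natDegree_C_mul_X_pow_le _ _).trans ?_
      omega
    exact natDegree_sub_le_of_le (this c) (this c')
  calc #{x ∈ range Q | ((e ((p c).eval (y x)) : Fin Q) : ℕ) = e ((p c').eval (y x))}
      ≤ #((p c - p c').roots.toFinset) := by
        refine card_le_card_of_injOn y ?_ ?_
        · intro x hx
          simp only [coe_filter, mem_range, Set.mem_ofPred_eq] at hx
          have := e.injective (Fin.ext hx.2)
          simp [hp, this]
        · intro x hx x' hx' hxx
          simp only [coe_filter, mem_range, Set.mem_ofPred_eq] at hx hx'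
          simp only [y, dif_pos hx.1, dif_pos hx'.1] at hxx
          simpa using e.symm.injective hxx
    _ ≤ Multiset.card (p c - p c').roots := Multiset.toFinset_card_le _
    _ ≤ 7 := (card_roots' _).trans hdeg

/-- The tower of field sizes `2, 4, 16, …`. -/
def fieldSize (j : ℕ) : ℕ := 2 ^ 2 ^ j

theorem fieldSize_pos (j : ℕ) : 0 < fieldSize j := by unfold fieldSize; positivity

theorem fieldSize_succ (j : ℕ) : fieldSize (j + 1) = fieldSize j ^ 2 := by
  unfold fieldSize
  rw [← pow_mul, pow_succ]

theorem fieldSize_add_three (j : ℕ) : fieldSize (j + 3) = fieldSize j ^ 8 := by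
  rw [fieldSize_succ, fieldSize_succ, fieldSize_succ, ← pow_mul, ← pow_mul]

theorem two_le_fieldSize (j : ℕ) : 2 ≤ fieldSize j := by
  unfold fieldSize
  calc 2 = 2 ^ 1 := rfl
    _ ≤ 2 ^ 2 ^ j := Nat.pow_le_pow_right (by norm_num) Nat.one_le_two_pow

theorem two_mul_fieldSize_le (j : ℕ) : 2 * fieldSize j ≤ fieldSize (j + 1) := by
  rw [fieldSize_succ, sq]
  exact Nat.mul_le_mul_right _ (two_le_fieldSize j)

theorem two_pow_mul_fieldSize_le (j i : ℕ) : 2 ^ i * fieldSize j ≤ fieldSize (j + i) := by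
  induction i with
  | zero => simp
  | succ i ih =>
    have := two_mul_fieldSize_le (j + i)
    rw [pow_succ, ← add_assoc]
    nlinarith

theorem fieldSize_mono {i j : ℕ} (h : i ≤ j) : fieldSize i ≤ fieldSize j :=
  Nat.pow_le_pow_right (by norm_num) (Nat.pow_le_pow_right (by norm_num) h)

theorem exists_code (j : ℕ) :
    ∃ f : ℕ → ℕ → ℕ, (∀ c x, f c x < fieldSize j) ∧
      ∀ c < fieldSize (j + 3), ∀ c' < fieldSize (j + 3), c ≠ c' →
        #{x ∈ range (fieldSize j) | f c x = f c' x} ≤ 7 := by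
  have := Fintype.ofFinite (GaloisField 2 (2 ^ j))
  have h : Fintype.card (GaloisField 2 (2 ^ j)) = fieldSize j := by
    rw [← Nat.card_eq_fintype_card, GaloisField.card 2 _ (by positivity)]
    rfl
  have := exists_code_of_field (GaloisField 2 (2 ^ j))
  rwa [h, ← fieldSize_add_three] at this

/-- A family of functions on `{0, …, fieldSize j - 1}`, any two of which agree in at most seven
points. -/
noncomputable def code (j : ℕ) : ℕ → ℕ → ℕ := (exists_code j).choose

theorem code_lt (j c x : ℕ) : code j c x < fieldSize j := (exists_code j).choose_spec.1 c x

theorem card_code_eq_le {j c c' : ℕ} (hc : c < fieldSize (j + 3)) (hc' : c' < fieldSize (j + 3))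
    (hne : c ≠ c') : #{x ∈ range (fieldSize j) | code j c x = code j c' x} ≤ 7 :=
  (exists_code j).choose_spec.2 c hc c' hc' hne

end Net

/-! ### Recursions of unbounded depth, defective colorings and splittings. -/

namespace Net

open Finset

open Classical in
/-- The value that a sequence takes at all large arguments. -/
noncomputable def eventualValue (s : ℕ → ℕ) : ℕ :=
  if h : ∃ x, ∀ᶠ f in atTop, s f = x then h.choose else 0

/-- The recursions below carry a depth parameter whose sufficient size depends on `n`. Taking the
value at all large depths removes this dependence from the definition of the color. -/
theorem eventualValue_eq {s : ℕ → ℕ} {x F : ℕ} (h : ∀ f, F ≤ f → s f = x) :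
    eventualValue s = x := by
  have hx : ∀ᶠ f in atTop, s f = x := eventually_atTop.2 ⟨F, h⟩
  have hex : ∃ x, ∀ᶠ f in atTop, s f = x := ⟨x, hx⟩
  rw [eventualValue, dif_pos hex]
  obtain ⟨f, h1, h2⟩ := (hex.choose_spec.and hx).exists
  exact h1.symm.trans h2

/-! ### Defective colorings -/

/-- The number of `u ∈ P` whose color `ψ u` differs from `ψ v` but has the same code at `x`. -/
noncomputable def collisions (j : ℕ) (P : Finset ℕ) (ψ : ℕ → ℕ) (v x : ℕ) : ℕ :=
  #{u ∈ P | ψ u ≠ ψ v ∧ code j (ψ u) x = code j (ψ v) x}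

/-- The color of `v` after one step of color reduction that takes the vertices of `P` into
account. -/
noncomputable def reduceColor (j : ℕ) (P : Finset ℕ) (ψ : ℕ → ℕ) (v : ℕ) : ℕ :=
  argmin (fieldSize j) (collisions j P ψ v) * fieldSize j +
    code j (ψ v) (argmin (fieldSize j) (collisions j P ψ v))

theorem reduceColor_lt (j : ℕ) (P : Finset ℕ) (ψ : ℕ → ℕ) (v : ℕ) :
    reduceColor j P ψ v < fieldSize (j + 1) := by
  have h1 := argmin_lt (fieldSize_pos j) (collisions j P ψ v)
  have h2 := code_lt j (ψ v) (argmin (fieldSize j) (collisions j P ψ v))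
  rw [fieldSize_succ, sq]
  unfold reduceColor
  nlinarith

theorem reduceColor_congr {j : ℕ} {P : Finset ℕ} {ψ ψ' : ℕ → ℕ} {v : ℕ}
    (h : ∀ u ∈ P, ψ u = ψ' u) (hv : ψ v = ψ' v) : reduceColor j P ψ v = reduceColor j P ψ' v := by
  have : collisions j P ψ v = collisions j P ψ' v := by
    funext x
    refine congrArg card (filter_congr fun u hu => ?_)
    rw [h u hu, hv]
  unfold reduceColor
  rw [this, hv]

/-- A reduced color has two digits in base `fieldSize j`, the chosen point and the code value there;
equal colors thus mean equal code values at a common point. -/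
theorem code_eq_of_reduceColor_eq {j : ℕ} {P P' : Finset ℕ} {ψ : ℕ → ℕ} {u v : ℕ}
    (h : reduceColor j P' ψ u = reduceColor j P ψ v) :
    code j (ψ u) (argmin (fieldSize j) (collisions j P ψ v)) =
      code j (ψ v) (argmin (fieldSize j) (collisions j P ψ v)) := by
  unfold reduceColor at h
  set x := argmin (fieldSize j) (collisions j P ψ v)
  set y := argmin (fieldSize j) (collisions j P' ψ u)
  have h1 := code_lt j (ψ u) y
  have h2 := code_lt j (ψ v) x
  have hd := congrArg (· / fieldSize j) h
  simp only [mul_comm _ (fieldSize j), Nat.mul_add_div (fieldSize_pos j), Nat.div_eq_of_lt h1,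
    Nat.div_eq_of_lt h2, add_zero] at hd
  rw [hd] at h
  rw [← hd] at h ⊢
  omega

/-- Each vertex of `P` with a different color collides at no more than 7 of the `fieldSize j`
points, so the best point does at least as well as the average. -/
theorem collisions_mul_le {j : ℕ} {P : Finset ℕ} {ψ : ℕ → ℕ} {v : ℕ}
    (hψ : ∀ u ∈ P, ψ u < fieldSize (j + 3)) (hv : ψ v < fieldSize (j + 3)) :
    collisions j P ψ v (argmin (fieldSize j) (collisions j P ψ v)) * fieldSize j ≤ 7 * #P := by
  rw [mul_comm]
  refine (mul_argmin_le (fieldSize_pos j) _).trans ?_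
  calc ∑ x ∈ range (fieldSize j), collisions j P ψ v x
      = ∑ x ∈ range (fieldSize j), ∑ u ∈ P,
          (if ψ u ≠ ψ v ∧ code j (ψ u) x = code j (ψ v) x then 1 else 0) := by
        simp only [collisions, card_filter]
    _ = ∑ u ∈ P, ∑ x ∈ range (fieldSize j),
          (if ψ u ≠ ψ v ∧ code j (ψ u) x = code j (ψ v) x then 1 else 0) := sum_comm
    _ ≤ ∑ u ∈ P, 7 := by
        refine sum_le_sum fun u hu => ?_
        rw [← card_filter]
        by_cases h : ψ u = ψ v
        · simp [h]
        · simpa [h] using card_code_eq_le (hψ u hu) hv h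
    _ = 7 * #P := by rw [sum_const, smul_eq_mul, mul_comm]

/-- Color reduction with respect to the neighbors in `out`. A vertex enters the reduction with its
shifted identity number at the first stage where that exceeds the current palette; the stages are
numbered downwards, and the first argument is the number of stages performed before the current
one. -/
noncomputable def reduction (j₀ : ℕ) (out : ℕ → Finset ℕ) : ℕ → ℕ → ℕ → ℕ
  | 0, _, v => v + fieldSize (j₀ + 2)
  | f + 1, j, v =>
    if v + fieldSize (j₀ + 2) < fieldSize (j + 2) then v + fieldSize (j₀ + 2)
    else reduceColor j {u ∈ out v | fieldSize (j + 2) ≤ u + fieldSize (j₀ + 2)}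
      (reduction j₀ out f (j + 1)) v

theorem reduction_of_lt {j₀ : ℕ} {out : ℕ → Finset ℕ} {f j v : ℕ}
    (h : v + fieldSize (j₀ + 2) < fieldSize (j + 2)) :
    reduction j₀ out f j v = v + fieldSize (j₀ + 2) := by
  cases f with
  | zero => rfl
  | succ f => rw [reduction, if_pos h]

theorem reduction_succ_of_le {j₀ : ℕ} {out : ℕ → Finset ℕ} {f j v : ℕ}
    (h : fieldSize (j + 2) ≤ v + fieldSize (j₀ + 2)) :
    reduction j₀ out (f + 1) j v =
      reduceColor j {u ∈ out v | fieldSize (j + 2) ≤ u + fieldSize (j₀ + 2)}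
        (reduction j₀ out f (j + 1)) v := by
  rw [reduction, if_neg h.not_gt]

theorem pos_of_fieldSize_le {j₀ J n f j v : ℕ} (hJ : n + fieldSize (j₀ + 2) ≤ fieldSize (J + 2))
    (hv : v < n) (hf : J ≤ j + f) (h : fieldSize (j + 2) ≤ v + fieldSize (j₀ + 2)) : 0 < f := by
  rcases Nat.eq_zero_or_pos f with rfl | hpos
  · have := fieldSize_mono (show J + 2 ≤ j + 2 by omega)
    omega
  · exact hpos

theorem reduction_lt {j₀ J n : ℕ} {out : ℕ → Finset ℕ} {f j v : ℕ}
    (hJ : n + fieldSize (j₀ + 2) ≤ fieldSize (J + 2)) (hv : v < n) (hf : J ≤ j + f)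
    (h : fieldSize (j + 2) ≤ v + fieldSize (j₀ + 2)) :
    reduction j₀ out f j v < fieldSize (j + 1) := by
  obtain ⟨f, rfl⟩ := Nat.exists_eq_succ_of_ne_zero (pos_of_fieldSize_le hJ hv hf h).ne'
  rw [Nat.succ_eq_add_one, reduction_succ_of_le h]
  exact reduceColor_lt _ _ _ _

/-- Stage `j` creates at most `7 * #(out v) / fieldSize j` new conflicts. Field sizes at least
double from one stage to the next higher one, so conflicts inherited from earlier stages contribute
at most the same amount again, whence 14. -/
theorem reduction_defect {j₀ J n : ℕ} {out : ℕ → Finset ℕ} {f j v : ℕ}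
    (hJ : n + fieldSize (j₀ + 2) ≤ fieldSize (J + 2)) (hn : ∀ v, ∀ u ∈ out v, u < n)
    (hirr : ∀ v, v ∉ out v) (hv : v < n) (hf : J ≤ j + f)
    (h : fieldSize (j + 2) ≤ v + fieldSize (j₀ + 2)) :
    #{u ∈ out v | fieldSize (j + 2) ≤ u + fieldSize (j₀ + 2) ∧
      reduction j₀ out f j u = reduction j₀ out f j v} * fieldSize j ≤ 14 * #(out v) := by
  induction f generalizing j v with
  | zero => exact absurd (pos_of_fieldSize_le hJ hv hf h) (lt_irrefl 0)
  | succ f ih =>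
    set ψ := reduction j₀ out f (j + 1) with hψ
    set P := {u ∈ out v | fieldSize (j + 2) ≤ u + fieldSize (j₀ + 2)} with hP
    have hmono : fieldSize (j + 2) ≤ fieldSize (j + 3) := fieldSize_mono (by omega)
    have hlt : ∀ u < n, ψ u < fieldSize (j + 3) := by
      intro u hu
      rcases lt_or_ge (u + fieldSize (j₀ + 2)) (fieldSize (j + 1 + 2)) with h' | h'
      · rw [hψ, reduction_of_lt h']
        exact h'
      · exact (reduction_lt hJ hu (by omega) h').trans_le hmono
    have hY : #{u ∈ P | ψ u = ψ v} * fieldSize j ≤ 7 * #(out v) := by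
      -- A vertex entering at this stage has no inherited conflict: other newcomers have distinct
      -- shifted identities, and vertices that entered before have colors below `fieldSize (j + 2)`,
      -- the least possible newcomer color. A vertex that entered earlier conflicts only with its
      -- like, which is the induction hypothesis.
      rcases lt_or_ge (v + fieldSize (j₀ + 2)) (fieldSize (j + 1 + 2)) with hv' | hv'
      · have : #{u ∈ P | ψ u = ψ v} = 0 := by
          rw [card_eq_zero, filter_eq_empty_iff]
          intro u hu huv
          rw [hP, mem_filter] at hu
          rw [hψ, reduction_of_lt hv'] at huv
          rcases lt_or_ge (u + fieldSize (j₀ + 2)) (fieldSize (j + 1 + 2)) with hu' | hu'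
          · rw [reduction_of_lt hu', Nat.add_right_cancel_iff] at huv
            exact hirr v (huv ▸ hu.1)
          · have := reduction_lt (out := out) (f := f) hJ (hn v u hu.1) (by omega) hu'
            rw [huv] at this
            exact (h.trans_lt this).ne rfl
        rw [this, zero_mul]
        exact Nat.zero_le _
      · have h1 := ih hv (by omega) hv'
        have h2 : #{u ∈ P | ψ u = ψ v} ≤ #{u ∈ out v | fieldSize (j + 1 + 2) ≤
            u + fieldSize (j₀ + 2) ∧ ψ u = ψ v} := by
          refine card_le_card fun u hu => ?_
          rw [hP, mem_filter, mem_filter] at hu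
          rw [mem_filter]
          refine ⟨hu.1.1, ?_, hu.2⟩
          by_contra hlt'
          push Not at hlt'
          have h3 := hu.2
          rw [hψ, reduction_of_lt hlt'] at h3
          have := reduction_lt (out := out) (f := f) hJ hv (by omega) hv'
          rw [← h3] at this
          exact (hu.1.2.trans_lt this).ne rfl
        have h3 := two_mul_fieldSize_le j
        have h4 := Nat.mul_le_mul h2 h3
        have := h4.trans h1
        nlinarith
    have hZ := collisions_mul_le (j := j) (P := P) (ψ := ψ) (v := v)
      (fun u hu => hlt u (hn v u (mem_of_mem_filter u hu))) (hlt v hv)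
    have hP' : #P ≤ #(out v) := card_filter_le _ _
    have hX : #{u ∈ out v | fieldSize (j + 2) ≤ u + fieldSize (j₀ + 2) ∧
        reduction j₀ out (f + 1) j u = reduction j₀ out (f + 1) j v} ≤
        #{u ∈ P | ψ u = ψ v} +
          collisions j P ψ v (argmin (fieldSize j) (collisions j P ψ v)) := by
      refine le_trans (card_le_card ?_) (card_union_le _ _)
      intro u hu
      rw [mem_filter] at hu
      obtain ⟨hu1, hu2, hu3⟩ := hu
      rw [reduction_succ_of_le hu2, reduction_succ_of_le h] at hu3
      have hc := code_eq_of_reduceColor_eq hu3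
      have huP : u ∈ P := mem_filter.2 ⟨hu1, hu2⟩
      rw [mem_union]
      by_cases he : ψ u = ψ v
      · exact Or.inl (mem_filter.2 ⟨huP, he⟩)
      · exact Or.inr (mem_filter.2 ⟨huP, he, hc⟩)
    calc _ ≤ (#{u ∈ P | ψ u = ψ v} +
          collisions j P ψ v (argmin (fieldSize j) (collisions j P ψ v))) * fieldSize j :=
          Nat.mul_le_mul_right _ hX
      _ ≤ 14 * #(out v) := by rw [add_mul]; omega

/-- Each stage looks one step further, and any two sufficient depths give the same value. Allowing
them to differ yields both convergence (with `N' = N`) and locality. -/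
theorem reduction_congr {N N' : Net} {j₀ J n t : ℕ} {out : Net → ℕ → Finset ℕ}
    (hJ : n + fieldSize (j₀ + 2) ≤ fieldSize (J + 2)) (hn : ∀ v, ∀ u ∈ out N v, u < n)
    (hsub : ∀ v, out N v ⊆ N.nbr v) (hdet : Det N n t out) {i f f' j v : ℕ} (hv : v < n)
    (hi : J ≤ j + i) (hf : J ≤ j + f) (hf' : J ≤ j + f') (h : Agree (t + i) N N' v) :
    reduction j₀ (out N) f j v = reduction j₀ (out N') f' j v := by
  induction i generalizing f f' j v with
  | zero =>
    have : v + fieldSize (j₀ + 2) < fieldSize (j + 2) := by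
      have := fieldSize_mono (show J + 2 ≤ j + 2 by omega)
      omega
    rw [reduction_of_lt this, reduction_of_lt this]
  | succ i ih =>
    rcases lt_or_ge (v + fieldSize (j₀ + 2)) (fieldSize (j + 2)) with h' | h'
    · rw [reduction_of_lt h', reduction_of_lt h']
    · obtain ⟨f, rfl⟩ := Nat.exists_eq_succ_of_ne_zero (pos_of_fieldSize_le hJ hv hf h').ne'
      obtain ⟨f', rfl⟩ := Nat.exists_eq_succ_of_ne_zero (pos_of_fieldSize_le hJ hv hf' h').ne'
      rw [Nat.succ_eq_add_one, Nat.succ_eq_add_one, reduction_succ_of_le h',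
        reduction_succ_of_le h', ← hdet N' v hv (h.mono (by omega))]
      refine reduceColor_congr (fun u hu => ?_) ?_
      · have hu' := mem_of_mem_filter u hu
        exact ih (hn v u hu') (by omega) (by omega) (by omega) (h.2 u (hsub v hu'))
      · exact ih hv (by omega) (by omega) (by omega) h.of_succ

/-- The defective coloring that results from the color reduction. -/
noncomputable def defectiveColor (j₀ : ℕ) (out : ℕ → Finset ℕ) (v : ℕ) : ℕ :=
  eventualValue fun f => reduction j₀ out f j₀ v

theorem reduction_eq_reduction {N : Net} {j₀ L n : ℕ} {out : ℕ → Finset ℕ}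
    (hL : n + fieldSize (j₀ + 2) ≤ fieldSize (j₀ + L + 2)) (hn : ∀ v, ∀ u ∈ out v, u < n)
    (hsub : ∀ v, out v ⊆ N.nbr v) {f v : ℕ} (hv : v < n) (hf : L ≤ f) :
    reduction j₀ out f j₀ v = reduction j₀ out L j₀ v :=
  reduction_congr (N := N) (N' := N) (t := 0) (out := fun _ => out) hL hn hsub
    (fun _ _ _ _ => rfl) (i := L) hv le_rfl (by omega) le_rfl (Agree.refl _ _ _)

theorem defectiveColor_eq {N : Net} {j₀ L n : ℕ} {out : ℕ → Finset ℕ}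
    (hL : n + fieldSize (j₀ + 2) ≤ fieldSize (j₀ + L + 2)) (hn : ∀ v, ∀ u ∈ out v, u < n)
    (hsub : ∀ v, out v ⊆ N.nbr v) {v : ℕ} (hv : v < n) :
    defectiveColor j₀ out v = reduction j₀ out L j₀ v :=
  eventualValue_eq fun _ hf => reduction_eq_reduction hL hn hsub hv hf

theorem det_defectiveColor {N : Net} {j₀ L n t : ℕ} {out : Net → ℕ → Finset ℕ}
    (hL : n + fieldSize (j₀ + 2) ≤ fieldSize (j₀ + L + 2)) (hn : ∀ v, ∀ u ∈ out N v, u < n)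
    (hsub : ∀ v, out N v ⊆ N.nbr v) (hdet : Det N n t out) :
    Det N n (t + L) fun N => defectiveColor j₀ (out N) := by
  intro N' v hv h
  change defectiveColor j₀ (out N) v = defectiveColor j₀ (out N') v
  rw [defectiveColor_eq hL hn hsub hv]
  refine (eventualValue_eq (F := L) fun f hf => ?_).symm
  exact (reduction_congr hL hn hsub hdet hv le_rfl le_rfl (by omega) h).symm

theorem defectiveColor_lt {N : Net} {j₀ L n : ℕ} {out : ℕ → Finset ℕ}
    (hL : n + fieldSize (j₀ + 2) ≤ fieldSize (j₀ + L + 2)) (hn : ∀ v, ∀ u ∈ out v, u < n)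
    (hsub : ∀ v, out v ⊆ N.nbr v) {v : ℕ} (hv : v < n) :
    defectiveColor j₀ out v < fieldSize (j₀ + 1) := by
  rw [defectiveColor_eq hL hn hsub hv]
  exact reduction_lt hL hv le_rfl (Nat.le_add_left _ _)

theorem defectiveColor_defect {N : Net} {j₀ L n : ℕ} {out : ℕ → Finset ℕ}
    (hL : n + fieldSize (j₀ + 2) ≤ fieldSize (j₀ + L + 2)) (hn : ∀ v, ∀ u ∈ out v, u < n)
    (hsub : ∀ v, out v ⊆ N.nbr v) {v : ℕ} (hv : v < n) :
    #{u ∈ out v | defectiveColor j₀ out u = defectiveColor j₀ out v} * fieldSize j₀ ≤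
      14 * #(out v) := by
  refine le_trans (Nat.mul_le_mul_right _ (card_le_card ?_))
    (reduction_defect hL hn (fun v h => N.irrefl v (hsub v h)) hv (le_refl (j₀ + L))
      (Nat.le_add_left _ _))
  intro u hu
  rw [mem_filter] at hu ⊢
  refine ⟨hu.1, Nat.le_add_left _ _, ?_⟩
  rw [← defectiveColor_eq hL hn hsub (hn v u hu.1), hu.2, defectiveColor_eq hL hn hsub hv]

/-! ### Splitting along a partial orientation -/

/-- The vertices choose one of `k` colors, in the order of decreasing `key`; each takes one that
is least used among its neighbors of larger key. -/
noncomputable def splitting (k : ℕ) (nb : ℕ → Finset ℕ) (key : ℕ → ℕ) : ℕ → ℕ → ℕ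
  | 0, _ => 0
  | f + 1, v => argmin k fun x => #{u ∈ nb v | key v < key u ∧ splitting k nb key f u = x}

/-- A vertex depends only on neighbors of strictly larger key, so chains of dependence have length
at most `B`. -/
theorem splitting_congr {N N' : Net} {k n t B : ℕ} {nb : Net → ℕ → Finset ℕ} {key : Net → ℕ → ℕ}
    (hn : ∀ v, ∀ u ∈ nb N v, u < n) (hsub : ∀ v, nb N v ⊆ N.nbr v) (hdet : Det N n t nb)
    (hdet' : Det N n t key) (hB : ∀ v < n, key N v < B) {i f f' v : ℕ} (hv : v < n)
    (hi : B ≤ key N v + i) (hf : B ≤ key N v + f) (hf' : B ≤ key N v + f')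
    (h : Agree (t + i) N N' v) :
    splitting k (nb N) (key N) f v = splitting k (nb N') (key N') f' v := by
  induction i generalizing f f' v with
  | zero => exact absurd (hB v hv) (by omega)
  | succ i ih =>
    have hBv := hB v hv
    obtain ⟨f, rfl⟩ := Nat.exists_eq_succ_of_ne_zero (show f ≠ 0 by omega)
    obtain ⟨f', rfl⟩ := Nat.exists_eq_succ_of_ne_zero (show f' ≠ 0 by omega)
    simp only [splitting]
    rw [← hdet N' v hv (h.mono (by omega)), ← hdet' N' v hv (h.mono (by omega))]
    congr 1
    funext x
    refine congrArg card (filter_congr fun u hu => ?_)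
    have hu' := h.2 u (hsub v hu)
    rw [← hdet' N' u (hn v u hu) (Agree.mono (Nat.le_add_right t i) hu')]
    refine and_congr_right fun hlt => ?_
    rw [ih (f := f) (f' := f') (hn v u hu) (by omega) (by omega) (by omega) hu']

/-- The limit of `splitting`. -/
noncomputable def splitColor (k : ℕ) (nb : ℕ → Finset ℕ) (key : ℕ → ℕ) (v : ℕ) : ℕ :=
  eventualValue fun f => splitting k nb key f v

theorem splitting_eq_splitColor {N : Net} {k n B : ℕ} {nb : ℕ → Finset ℕ} {key : ℕ → ℕ}
    (hn : ∀ v, ∀ u ∈ nb v, u < n) (hsub : ∀ v, nb v ⊆ N.nbr v) (hB : ∀ v < n, key v < B)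
    {f v : ℕ} (hv : v < n) (hf : B ≤ f) : splitting k nb key f v = splitColor k nb key v := by
  refine (eventualValue_eq (F := B) fun f' hf' => ?_).symm
  exact splitting_congr (N := N) (N' := N) (t := 0) (nb := fun _ => nb) (key := fun _ => key)
    hn hsub (fun _ _ _ _ => rfl) (fun _ _ _ _ => rfl) hB (i := B) hv (by omega) (by omega)
    (by omega) (Agree.refl _ _ _)

theorem det_splitColor {N : Net} {k n t B : ℕ} {nb : Net → ℕ → Finset ℕ} {key : Net → ℕ → ℕ}
    (hn : ∀ v, ∀ u ∈ nb N v, u < n) (hsub : ∀ v, nb N v ⊆ N.nbr v) (hdet : Det N n t nb)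
    (hdet' : Det N n t key) (hB : ∀ v < n, key N v < B) :
    Det N n (t + B) fun N => splitColor k (nb N) (key N) := by
  intro N' v hv h
  change splitColor k (nb N) (key N) v = splitColor k (nb N') (key N') v
  rw [← splitting_eq_splitColor hn hsub hB hv le_rfl]
  refine (eventualValue_eq (F := B) fun f' hf' => ?_).symm
  exact (splitting_congr hn hsub hdet hdet' hB hv (by omega) (by omega) (by omega) h).symm

theorem splitColor_eq_argmin {N : Net} {k n B : ℕ} {nb : ℕ → Finset ℕ} {key : ℕ → ℕ}
    (hn : ∀ v, ∀ u ∈ nb v, u < n) (hsub : ∀ v, nb v ⊆ N.nbr v) (hB : ∀ v < n, key v < B)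
    {v : ℕ} (hv : v < n) :
    splitColor k nb key v =
      argmin k fun x => #{u ∈ nb v | key v < key u ∧ splitColor k nb key u = x} := by
  rw [← splitting_eq_splitColor hn hsub hB hv (Nat.le_succ B), splitting]
  congr 1
  funext x
  refine congrArg card (filter_congr fun u hu => ?_)
  rw [splitting_eq_splitColor hn hsub hB (hn v u hu) le_rfl]

theorem splitColor_lt {N : Net} {k n B : ℕ} {nb : ℕ → Finset ℕ} {key : ℕ → ℕ} (hk : 0 < k)
    (hn : ∀ v, ∀ u ∈ nb v, u < n) (hsub : ∀ v, nb v ⊆ N.nbr v) (hB : ∀ v < n, key v < B)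
    {v : ℕ} (hv : v < n) : splitColor k nb key v < k := by
  rw [splitColor_eq_argmin hn hsub hB hv]
  exact argmin_lt hk _

theorem splitColor_defect {N : Net} {k n B : ℕ} {nb : ℕ → Finset ℕ} {key : ℕ → ℕ} (hk : 0 < k)
    (hn : ∀ v, ∀ u ∈ nb v, u < n) (hsub : ∀ v, nb v ⊆ N.nbr v) (hB : ∀ v < n, key v < B)
    {v : ℕ} (hv : v < n) :
    k * #{u ∈ nb v | key v < key u ∧ splitColor k nb key u = splitColor k nb key v} ≤
      #{u ∈ nb v | key v < key u} := by
  have h := mul_argmin_le hk fun x => #{u ∈ nb v | key v < key u ∧ splitColor k nb key u = x}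
  rw [← splitColor_eq_argmin hn hsub hB hv] at h
  refine h.trans ?_
  simp_rw [← filter_filter]
  rw [sum_card_fiberwise_eq_card_filter]
  exact card_filter_le _ _

end Net

/-! ### Arbdefective splitting and its iteration. -/

namespace Net

open Finset

/-- `nb` is the neighborhood function of a subgraph of `N` on the vertices `0, …, n - 1`. -/
structure IsSub (N : Net) (n : ℕ) (nb : ℕ → Finset ℕ) : Prop where
  sub : ∀ v, nb v ⊆ N.nbr v
  lt : ∀ v, ∀ u ∈ nb v, u < n
  symm : ∀ {u v}, u ∈ nb v → v ∈ nb u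

theorem IsSub.eq_empty {N : Net} {n : ℕ} {nb : ℕ → Finset ℕ} (h : IsSub N n nb) {v : ℕ}
    (hv : n ≤ v) : nb v = ∅ := by
  rw [eq_empty_iff_forall_notMem]
  exact fun u hu => (h.lt u v (h.symm hu)).not_ge hv

theorem IsSub.card_ball_le {N : Net} {n : ℕ} {nb : ℕ → Finset ℕ} (h : IsSub N n nb)
    (hpos : 0 < n) (r v : ℕ) : #(ball nb r v) ≤ n :=
  Net.card_ball_le h.lt (fun _ hv => h.eq_empty hv) hpos r v

theorem IsSub.not_unpeeled {N : Net} {n L D A : ℕ} {nb : ℕ → Finset ℕ} (h : IsSub N n nb)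
    (hpos : 0 < n) (hL : n < 2 ^ L) (hs : Sparse nb D) (hA : 4 * D ≤ A) (v : ℕ) :
    ¬ Unpeeled nb A L v := fun hu =>
  ((two_pow_le_card_ball hs hA hu).trans (h.card_ball_le hpos L v)).not_gt hL

theorem det_unpeeled {N : Net} {n t : ℕ} {nb : Net → ℕ → Finset ℕ} (h : IsSub N n (nb N))
    (hdet : Det N n t nb) (A r : ℕ) : Det N n (t + r) fun N => Unpeeled (nb N) A r := by
  classical
  induction r with
  | zero => exact fun _ _ _ _ => rfl
  | succ r ih =>
    intro N' v hv hag
    simp only [Unpeeled]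
    rw [← hdet N' v hv (hag.mono (by omega))]
    refine congrArg (A < #·) (filter_congr fun u hu => ?_)
    exact iff_of_eq (ih N' u (h.lt v u hu) (hag.2 u (h.sub v hu)))

theorem det_ball {N : Net} {n t : ℕ} {nb : Net → ℕ → Finset ℕ} (h : IsSub N n (nb N))
    (hdet : Det N n t nb) (r : ℕ) : Det N n (t + r) fun N => ball (nb N) r := by
  induction r with
  | zero => exact fun _ _ _ _ => rfl
  | succ r ih =>
    intro N' v hv hag
    simp only [ball]
    rw [← hdet N' v hv (hag.mono (by omega))]
    refine congrArg (insert v) (biUnion_congr rfl fun u hu => ?_)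
    exact ih N' u (h.lt v u hu) (hag.2 u (h.sub v hu))

theorem det_level {N : Net} {n t L A : ℕ} {nb : Net → ℕ → Finset ℕ} (h : IsSub N n (nb N))
    (hdet : Det N n t nb) (hL : ∀ v, ¬ Unpeeled (nb N) A L v) :
    Det N n (t + L) fun N => level (nb N) A := by
  intro N' v hv hag
  have hu : ∀ r ≤ L, Unpeeled (nb N) A r v = Unpeeled (nb N') A r v := fun r hr =>
    det_unpeeled h hdet A r N' v hv (hag.mono (by omega))
  have hle := level_le (hL v)
  change level (nb N) A v = level (nb N') A v
  refine le_antisymm (le_of_not_gt fun hlt => ?_) (level_le ?_)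
  · have h1 := unpeeled_of_lt_level hlt
    rw [hu _ (by omega)] at h1
    have h2 : ¬ Unpeeled (nb N') A L v := hu L le_rfl ▸ hL v
    exact not_unpeeled_level h2 h1
  · rw [← hu _ hle]
    exact not_unpeeled_level (hL v)

theorem det_filter {N : Net} {n t : ℕ} {X : Type*} {nb : Net → ℕ → Finset ℕ} {f : Net → ℕ → X}
    (h : IsSub N n (nb N)) (hdet : Det N n t nb) (hf : Det N n t f) (p : X → X → Prop)
    [∀ x y, Decidable (p x y)] :
    Det N n (t + 1) fun N v => {u ∈ nb N v | p (f N u) (f N v)} := by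
  intro N' v hv hag
  change {u ∈ nb N v | p (f N u) (f N v)} = {u ∈ nb N' v | p (f N' u) (f N' v)}
  rw [← hdet N' v hv (hag.mono (by omega)), ← hf N' v hv (hag.mono (by omega))]
  refine filter_congr fun u hu => ?_
  rw [← hf N' u (h.lt v u hu) (hag.2 u (h.sub v hu))]

/-- The neighbors that are removed no earlier than the vertex itself. -/
noncomputable def peelOut (nb : ℕ → Finset ℕ) (A v : ℕ) : Finset ℕ :=
  {u ∈ nb v | level nb A v ≤ level nb A u}

/-- The vertices are ordered by their levels, and by a defective coloring within these. -/
noncomputable def splitKey (j₀ : ℕ) (nb : ℕ → Finset ℕ) (A v : ℕ) : ℕ :=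
  level nb A v * fieldSize (j₀ + 1) + defectiveColor j₀ (peelOut nb A) v

/-- The arbdefective coloring with `k` colors. -/
noncomputable def split (k j₀ : ℕ) (nb : ℕ → Finset ℕ) (A : ℕ) : ℕ → ℕ :=
  splitColor k nb (splitKey j₀ nb A)

/-- The neighbors of the same color. -/
def restrict (nb : ℕ → Finset ℕ) (c : ℕ → ℕ) (v : ℕ) : Finset ℕ := {u ∈ nb v | c u = c v}

theorem IsSub.restrict {N : Net} {n : ℕ} {nb : ℕ → Finset ℕ} (h : IsSub N n nb) (c : ℕ → ℕ) :
    IsSub N n (restrict nb c) where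
  sub v := (filter_subset _ _).trans (h.sub v)
  lt v u hu := h.lt v u (mem_of_mem_filter u hu)
  symm {u v} hu := by
    rw [Net.restrict, mem_filter] at hu ⊢
    exact ⟨h.symm hu.1, hu.2.symm⟩

/-- The number of reduction stages could be bounded far better, but `O(log n)` is enough, as peeling
costs that much anyway. -/
theorem add_fieldSize_le {n L : ℕ} (hL : n < 2 ^ L) (j : ℕ) :
    n + fieldSize (j + 2) ≤ fieldSize (j + L + 2) := by
  have h := two_pow_mul_fieldSize_le (j + 2) L
  have h1 := fieldSize_pos (j + 2)
  rw [show j + L + 2 = j + 2 + L by ring]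
  nlinarith

section Split

variable {N : Net} {n L D j₀ : ℕ} {nb : ℕ → Finset ℕ}

theorem defectiveColor_peelOut_lt (h : IsSub N n nb) (hL : n < 2 ^ L) {A v : ℕ} (hv : v < n) :
    defectiveColor j₀ (peelOut nb A) v < fieldSize (j₀ + 1) :=
  defectiveColor_lt (N := N) (add_fieldSize_le hL j₀)
    (fun v u hu => h.lt v u (mem_of_mem_filter u hu))
    (fun v => (filter_subset _ _).trans (h.sub v)) hv

theorem splitKey_lt (h : IsSub N n nb) (hL : n < 2 ^ L) (hs : Sparse nb D) {v : ℕ} (hv : v < n) :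
    splitKey j₀ nb (4 * D) v < (L + 1) * fieldSize (j₀ + 1) := by
  have h1 := defectiveColor_peelOut_lt (j₀ := j₀) (A := 4 * D) h hL hv
  have h2 := level_le (h.not_unpeeled (by omega) hL hs le_rfl v)
  unfold splitKey
  nlinarith

theorem split_lt (h : IsSub N n nb) (hL : n < 2 ^ L) (hs : Sparse nb D) {k v : ℕ} (hk : 0 < k)
    (hv : v < n) : split k j₀ nb (4 * D) v < k :=
  splitColor_lt hk h.lt h.sub (fun _ hv => splitKey_lt h hL hs hv) hv

/-- Orient each edge inside a class towards the endpoint of larger or equal key. Neighbors of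
strictly larger key are among the at most `4 * D` peeling out-neighbors, and the least used color is
shared by at most a `1 / k` fraction of them. Equal keys mean equal level and equal defective color,
giving at most `14 * (4 * D) / fieldSize j₀ ≤ 4 * D / k` further neighbors. -/
theorem sparse_restrict_split (h : IsSub N n nb) (hL : n < 2 ^ L) (hs : Sparse nb D) {k : ℕ}
    (hk : 0 < k) (hj : 14 * k ≤ fieldSize j₀) :
    Sparse (restrict nb (split k j₀ nb (4 * D))) (2 * (4 * D / k)) := by
  set c := split k j₀ nb (4 * D) with hc
  set key := splitKey j₀ nb (4 * D) with hkey
  refine Sparse.of_orientation (out := fun v => {u ∈ restrict nb c v | key v ≤ key u}) ?_ ?_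
  · intro v u hu
    simp only [mem_filter]
    rcases le_total (key v) (key u) with hle | hle
    · exact Or.inl ⟨hu, hle⟩
    · exact Or.inr ⟨(h.restrict c).symm hu, hle⟩
  · intro v
    rcases lt_or_ge v n with hv | hv
    swap
    · rw [(h.restrict c).eq_empty hv]
      simp
    have hpeel : #(peelOut nb (4 * D) v) ≤ 4 * D :=
      card_level_le (h.not_unpeeled (by omega) hL hs le_rfl v)
    have hlt : ∀ u < n, defectiveColor j₀ (peelOut nb (4 * D)) u < fieldSize (j₀ + 1) :=
      fun u hu => defectiveColor_peelOut_lt h hL hu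
    have h1 : k * #{u ∈ nb v | key v < key u ∧ c u = c v} ≤ 4 * D := by
      refine (splitColor_defect hk h.lt h.sub (fun _ hv => splitKey_lt h hL hs hv) hv).trans
        ((card_le_card fun u hu => ?_).trans hpeel)
      rw [mem_filter] at hu
      refine mem_filter.2 ⟨hu.1, ?_⟩
      -- The level is the leading digit of the key, since defective colors stay below `fieldSize (j₀
      -- + 1)`.
      by_contra hlev
      push Not at hlev
      have h3 := hu.2
      unfold splitKey at h3
      have h4 := hlt u (h.lt v u hu.1)
      nlinarith
    have h2 : k * #{u ∈ peelOut nb (4 * D) v | defectiveColor j₀ (peelOut nb (4 * D)) u =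
        defectiveColor j₀ (peelOut nb (4 * D)) v} ≤ 4 * D := by
      have h3 := defectiveColor_defect (N := N) (add_fieldSize_le hL j₀)
        (fun v u hu => h.lt v u (mem_of_mem_filter (s := nb v) u hu))
        (fun v => (filter_subset _ (nb v)).trans (h.sub v)) hv
        (out := peelOut nb (4 * D)) (j₀ := j₀)
      have h4 := Nat.mul_le_mul_left (#{u ∈ peelOut nb (4 * D) v | defectiveColor j₀
        (peelOut nb (4 * D)) u = defectiveColor j₀ (peelOut nb (4 * D)) v}) hj
      nlinarith
    have h5 : #{u ∈ restrict nb c v | key v ≤ key u} ≤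
        #{u ∈ nb v | key v < key u ∧ c u = c v} +
        #{u ∈ peelOut nb (4 * D) v | defectiveColor j₀ (peelOut nb (4 * D)) u =
          defectiveColor j₀ (peelOut nb (4 * D)) v} := by
      refine le_trans (card_le_card fun u hu => ?_) (card_union_le _ _)
      rw [restrict, filter_filter, mem_filter] at hu
      obtain ⟨hu1, hu2, hu3⟩ := hu
      rw [mem_union]
      rcases hu3.lt_or_eq with hlt' | heq
      · exact Or.inl (mem_filter.2 ⟨hu1, hlt', hu2⟩)
      · right
        have h4 := hlt u (h.lt v u hu1)
        have h4' := hlt v hv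
        rw [hkey] at heq
        unfold splitKey at heq
        have hpos := fieldSize_pos (j₀ + 1)
        have hd := congrArg (· / fieldSize (j₀ + 1)) heq
        simp only [mul_comm _ (fieldSize (j₀ + 1)), Nat.mul_add_div hpos, Nat.div_eq_of_lt h4,
          Nat.div_eq_of_lt h4', add_zero] at hd
        rw [hd] at heq
        refine mem_filter.2 ⟨mem_filter.2 ⟨hu1, hd.le⟩, ?_⟩
        omega
    have h6 := (Nat.le_div_iff_mul_le hk).2 (mul_comm k _ ▸ h1)
    have h7 := (Nat.le_div_iff_mul_le hk).2 (mul_comm k _ ▸ h2)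
    omega

end Split

theorem det_split {N : Net} {n t L D j₀ : ℕ} {nb : Net → ℕ → Finset ℕ} (k : ℕ)
    (h : IsSub N n (nb N)) (hdet : Det N n t nb) (hpos : 0 < n) (hL : n < 2 ^ L)
    (hs : Sparse (nb N) D) :
    Det N n (t + (L + 1) * (fieldSize (j₀ + 1) + 2))
      fun N => split k j₀ (nb N) (4 * D) := by
  have hlev : Det N n (t + L) fun N => level (nb N) (4 * D) :=
    det_level h hdet fun v => h.not_unpeeled hpos hL hs le_rfl v
  have hout : Det N n (t + L + 1) fun N => peelOut (nb N) (4 * D) :=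
    det_filter h (hdet.mono (by omega)) hlev fun x y => y ≤ x
  have hdef : Det N n (t + L + 1 + L) fun N => defectiveColor j₀ (peelOut (nb N) (4 * D)) :=
    det_defectiveColor (add_fieldSize_le hL j₀)
      (fun v u hu => h.lt v u (mem_of_mem_filter u hu))
      (fun v => (filter_subset _ _).trans (h.sub v)) hout
  have hkey : Det N n (t + L + 1 + L) fun N => splitKey j₀ (nb N) (4 * D) := by
    intro N' v hv hag
    have h1 := hlev N' v hv (hag.mono (by omega))
    have h2 := hdef N' v hv hag
    exact congrArg₂ (fun x y => x * fieldSize (j₀ + 1) + y) h1 h2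
  refine (det_splitColor h.lt h.sub (hdet.mono (by omega)) hkey
    fun _ hv => splitKey_lt h hL hs hv).mono ?_
  rw [mul_add]
  omega

theorem det_restrict {N : Net} {n t : ℕ} {nb : Net → ℕ → Finset ℕ} {c : Net → ℕ → ℕ}
    (h : IsSub N n (nb N)) (hdet : Det N n t nb) (hc : Det N n t c) :
    Det N n (t + 1) fun N => restrict (nb N) (c N) :=
  det_filter h hdet hc fun x y => x = y

/-- The coloring obtained by iterated splitting, for a graph of sparsity `2 ^ (b * s) - 1`. -/
noncomputable def iterSplit (k j₀ b : ℕ) : ℕ → (ℕ → Finset ℕ) → ℕ → ℕ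
  | 0, _, _ => 0
  | s + 1, nb, v =>
    split k j₀ nb (4 * (2 ^ (b * (s + 1)) - 1)) v +
      k * iterSplit k j₀ b s (restrict nb (split k j₀ nb (4 * (2 ^ (b * (s + 1)) - 1)))) v

theorem Sparse.mono {nb : ℕ → Finset ℕ} {D D' : ℕ} (h : Sparse nb D) (hD : D ≤ D') :
    Sparse nb D' := fun S => (h S).trans (by gcongr)

/-- The extra factor 8 in `2 ^ (b + 3)` absorbs the loss of 4 in the peeling threshold and of 2 from
the two kinds of out-neighbors, so each splitting gains a full factor `2 ^ b`. -/
theorem two_mul_div_lt (b s : ℕ) :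
    2 * (4 * (2 ^ (b * (s + 1)) - 1) / 2 ^ (b + 3)) ≤ 2 ^ (b * s) - 1 := by
  have h1 : 2 ^ (b * (s + 1)) = 2 ^ b * 2 ^ (b * s) := by rw [← pow_add]; ring_nf
  have h2 : 2 ^ (b + 3) = 2 ^ b * 8 := by rw [pow_add]; norm_num
  have hb : 0 < 2 ^ b := by positivity
  have hs : 0 < 2 ^ (b * s) := by positivity
  have h3 := Nat.div_mul_le_self (4 * (2 ^ (b * (s + 1)) - 1)) (2 ^ (b + 3))
  set q := 4 * (2 ^ (b * (s + 1)) - 1) / 2 ^ (b + 3)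
  rw [h2] at h3
  have h4 : 4 * (2 ^ (b * (s + 1)) - 1) < 4 * (2 ^ b * 2 ^ (b * s)) := by
    have : 0 < 2 ^ b * 2 ^ (b * s) := by positivity
    omega
  have h5 : 2 ^ b * (q * 8) < 2 ^ b * (4 * 2 ^ (b * s)) := by nlinarith
  have := lt_of_mul_lt_mul_left h5 (Nat.zero_le _)
  omega

theorem iterSplit_lt {N : Net} {n L j₀ b s : ℕ} {nb : ℕ → Finset ℕ} (h : IsSub N n nb)
    (hL : n < 2 ^ L) (hj : 14 * 2 ^ (b + 3) ≤ fieldSize j₀) (hs : Sparse nb (2 ^ (b * s) - 1))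
    {v : ℕ} (hv : v < n) : iterSplit (2 ^ (b + 3)) j₀ b s nb v < 2 ^ ((b + 3) * s) := by
  induction s generalizing nb with
  | zero => simp [iterSplit]
  | succ s ih =>
    have hk : 0 < 2 ^ (b + 3) := by positivity
    have h1 := split_lt (j₀ := j₀) h hL hs hk hv
    have h2 := ih (h.restrict _)
      ((sparse_restrict_split h hL hs hk hj).mono (two_mul_div_lt b s))
    rw [iterSplit, show 2 ^ ((b + 3) * (s + 1)) = 2 ^ (b + 3) * 2 ^ ((b + 3) * s) by
      rw [← pow_add]; ring_nf]
    generalize 2 ^ (b + 3) = k at *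
    nlinarith

/-- The successive classes are the digits of the color in base `2 ^ (b + 3)`. Neighbors that agree
in all digits would remain adjacent down to sparsity 0, where no edges are left. -/
theorem iterSplit_ne {N : Net} {n L j₀ b s : ℕ} {nb : ℕ → Finset ℕ} (h : IsSub N n nb)
    (hL : n < 2 ^ L) (hj : 14 * 2 ^ (b + 3) ≤ fieldSize j₀) (hs : Sparse nb (2 ^ (b * s) - 1))
    {u v : ℕ} (hu : u ∈ nb v) :
    iterSplit (2 ^ (b + 3)) j₀ b s nb u ≠ iterSplit (2 ^ (b + 3)) j₀ b s nb v := by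
  induction s generalizing nb with
  | zero =>
    have : nb v = ∅ := Sparse.eq_empty (by simpa using hs) v
    simp [this] at hu
  | succ s ih =>
    have hk : 0 < 2 ^ (b + 3) := by positivity
    have h1 := split_lt (j₀ := j₀) h hL hs hk (h.lt v u hu)
    have h2 := split_lt (j₀ := j₀) h hL hs hk (h.lt u v (h.symm hu))
    have h3 := ih (h.restrict _)
      ((sparse_restrict_split h hL hs hk hj).mono (two_mul_div_lt b s))
    intro heq
    rw [iterSplit, iterSplit] at heq
    have hm := congrArg (· % 2 ^ (b + 3)) heq
    simp only [Nat.add_mul_mod_self_left, Nat.mod_eq_of_lt h1, Nat.mod_eq_of_lt h2] at hm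
    refine h3 (mem_filter.2 ⟨hu, hm⟩) ?_
    rw [hm, Nat.add_left_cancel_iff] at heq
    exact Nat.eq_of_mul_eq_mul_left hk heq

theorem det_iterSplit {N : Net} {n t L j₀ b s : ℕ} {nb : Net → ℕ → Finset ℕ}
    (h : IsSub N n (nb N)) (hdet : Det N n t nb) (hpos : 0 < n) (hL : n < 2 ^ L)
    (hj : 14 * 2 ^ (b + 3) ≤ fieldSize j₀) (hs : Sparse (nb N) (2 ^ (b * s) - 1)) :
    Det N n (t + s * ((L + 1) * (fieldSize (j₀ + 1) + 3)))
      fun N => iterSplit (2 ^ (b + 3)) j₀ b s (nb N) := by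
  induction s generalizing nb t with
  | zero => exact fun _ _ _ _ => rfl
  | succ s ih =>
    have hk : 0 < 2 ^ (b + 3) := by positivity
    have h1 := det_split (j₀ := j₀) (2 ^ (b + 3)) h hdet hpos hL hs
    have h2 := det_restrict h (hdet.mono (Nat.le_add_right _ _)) h1
    have h3 := ih (h.restrict _) h2
      ((sparse_restrict_split h hL hs hk hj).mono (two_mul_div_lt b s))
    have hle : t + (L + 1) * (fieldSize (j₀ + 1) + 2) + 1 ≤
        t + (L + 1) * (fieldSize (j₀ + 1) + 3) := by nlinarith
    have hle' : t + (s + 1) * ((L + 1) * (fieldSize (j₀ + 1) + 3)) =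
      t + (L + 1) * (fieldSize (j₀ + 1) + 3) + s * ((L + 1) * (fieldSize (j₀ + 1) + 3)) := by ring
    intro N' v hv hag
    rw [hle'] at hag
    have h1' := h1 N' v hv (hag.mono (by omega))
    have h3' := h3 N' v hv (hag.mono (by omega))
    simp only [iterSplit]
    exact congrArg₂ (fun x y => x + 2 ^ (b + 3) * y) h1' h3'

end Net

/-! ### Unknown sparsity, disjoint palettes and greedy reduction. -/

namespace Net

open Finset

/-! ### Guessing the sparsity -/

/-- The vertex `v` is removed by peeling with threshold `A`, and the balls around it grow
exponentially until then. -/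
def Accepted (nb : ℕ → Finset ℕ) (A v : ℕ) : Prop :=
  ∃ r, ¬ Unpeeled nb A r v ∧ ∀ s < r, 2 ^ s ≤ #(ball nb s v)

/-- The least threshold exponent that a vertex accepts. -/
noncomputable def guess (b : ℕ) (nb : ℕ → Finset ℕ) (v : ℕ) : ℕ :=
  sInf {i | Accepted nb (2 ^ (b * i) - 1) v}

theorem accepted_guess {b : ℕ} (hb : 0 < b) (nb : ℕ → Finset ℕ) (v : ℕ) :
    Accepted nb (2 ^ (b * guess b nb v) - 1) v := by
  classical
  -- A threshold of at least the degree removes `v` in the first round, where the growth condition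
  -- concerns only the ball of radius 0.
  refine Nat.sInf_mem (s := {i | Accepted nb (2 ^ (b * i) - 1) v}) ⟨#(nb v), 1, ?_, ?_⟩
  · rw [Unpeeled, not_lt]
    refine (card_filter_le _ _).trans ?_
    have h1 : #(nb v) < 2 ^ #(nb v) := Nat.lt_two_pow_self
    have h2 : 2 ^ #(nb v) ≤ 2 ^ (b * #(nb v)) :=
      Nat.pow_le_pow_right (by norm_num) (Nat.le_mul_of_pos_left _ hb)
    omega
  · intro s hs
    obtain rfl : s = 0 := by omega
    simp [ball]

/-- Once the threshold reaches `4 * a`, every vertex is removed and its balls double until then, so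
the test succeeds. -/
theorem guess_le {N : Net} {n L a b I : ℕ} {nb : ℕ → Finset ℕ} (h : IsSub N n nb) (hpos : 0 < n)
    (hL : n < 2 ^ L) (hs : Sparse nb a) (hI : 4 * a < 2 ^ (b * I)) (v : ℕ) :
    guess b nb v ≤ I := by
  have hA : 4 * a ≤ 2 ^ (b * I) - 1 := by omega
  refine Nat.sInf_le ⟨_, not_unpeeled_level (h.not_unpeeled hpos hL hs hA v), fun s hs' => ?_⟩
  exact two_pow_le_card_ball hs hA (unpeeled_of_lt_level hs')

/-- The growth condition makes acceptance local: no ball has more than `n < 2 ^ L` vertices, so a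
witnessing round beyond `L` is impossible. Without it, rejection might take arbitrarily many rounds
to establish. -/
theorem det_accepted {N : Net} {n t L : ℕ} {nb : Net → ℕ → Finset ℕ} (h : IsSub N n (nb N))
    (hdet : Det N n t nb) (hpos : 0 < n) (hL : n < 2 ^ L) (A : ℕ) :
    Det N n (t + L) fun N => Accepted (nb N) A := by
  intro N' v hv hag
  have hu : ∀ r ≤ L, Unpeeled (nb N) A r v = Unpeeled (nb N') A r v := fun r hr =>
    det_unpeeled h hdet A r N' v hv (hag.mono (by omega))
  have hb : ∀ r ≤ L, ball (nb N) r v = ball (nb N') r v := fun r hr =>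
    det_ball h hdet r N' v hv (hag.mono (by omega))
  have hsmall := h.card_ball_le hpos L v
  refine propext ⟨?_, ?_⟩
  · rintro ⟨r, hr, hr'⟩
    have hrL : r ≤ L := by
      by_contra! hlt
      have := hr' L hlt
      omega
    exact ⟨r, hu r hrL ▸ hr, fun s hs => hb s (by omega) ▸ hr' s hs⟩
  · rintro ⟨r, hr, hr'⟩
    have hrL : r ≤ L := by
      by_contra! hlt
      have := hr' L hlt
      rw [← hb L le_rfl] at this
      omega
    exact ⟨r, (hu r hrL).symm ▸ hr, fun s hs => (hb s (by omega)).symm ▸ hr' s hs⟩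

theorem det_guess {N : Net} {n t L : ℕ} {nb : Net → ℕ → Finset ℕ} (h : IsSub N n (nb N))
    (hdet : Det N n t nb) (hpos : 0 < n) (hL : n < 2 ^ L) (b : ℕ) :
    Det N n (t + L) fun N => guess b (nb N) := by
  intro N' v hv hag
  refine congrArg sInf (Set.ext fun i => ?_)
  exact iff_of_eq (det_accepted h hdet hpos hL _ N' v hv hag)

/-- The subgraph spanned by the vertices with guess `i`. -/
noncomputable def classNbr (b : ℕ) (nb : ℕ → Finset ℕ) (i v : ℕ) : Finset ℕ :=
  {u ∈ nb v | guess b nb u = i ∧ guess b nb v = i}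

theorem IsSub.classNbr {N : Net} {n : ℕ} {nb : ℕ → Finset ℕ} (h : IsSub N n nb) (b i : ℕ) :
    IsSub N n (classNbr b nb i) where
  sub v := (filter_subset _ _).trans (h.sub v)
  lt v u hu := h.lt v u (mem_of_mem_filter u hu)
  symm {u v} hu := by
    rw [Net.classNbr, mem_filter] at hu ⊢
    exact ⟨h.symm hu.1, hu.2.symm⟩

/-- Vertices that accepted the same threshold are removed by peeling the whole graph with it, and
those levels orient the edges of the class. The density is thus controlled even if the guess is far
below the arboricity. -/
theorem IsSub.sparse_classNbr {N : Net} {n b : ℕ} {nb : ℕ → Finset ℕ} (h : IsSub N n nb)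
    (hb : 0 < b) (i : ℕ) : Sparse (Net.classNbr b nb i) (2 ^ (b * i) - 1) := by
  set A := 2 ^ (b * i) - 1 with hA
  refine Sparse.of_orientation
    (out := fun v => {u ∈ Net.classNbr b nb i v | level nb A v ≤ level nb A u}) ?_ ?_
  · intro v u hu
    simp only [mem_filter]
    rcases le_total (level nb A v) (level nb A u) with hle | hle
    · exact Or.inl ⟨hu, hle⟩
    · exact Or.inr ⟨(h.classNbr b i).symm hu, hle⟩
  · intro v
    by_cases hv : guess b nb v = i
    · obtain ⟨r, hr, -⟩ := accepted_guess hb nb v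
      rw [hv] at hr
      refine le_trans (card_le_card ?_) (card_level_le hr)
      exact filter_subset_filter _ (filter_subset _ _)
    · simp [Net.classNbr, hv]

theorem det_classNbr {N : Net} {n t L : ℕ} {nb : Net → ℕ → Finset ℕ} (h : IsSub N n (nb N))
    (hdet : Det N n t nb) (hpos : 0 < n) (hL : n < 2 ^ L) (b i : ℕ) :
    Det N n (t + L + 1) fun N => classNbr b (nb N) i :=
  det_filter h (hdet.mono (by omega)) (det_guess h hdet hpos hL b) fun x y => x = i ∧ y = i

/-- Iterated splitting of each of the subgraphs, with disjoint palettes. -/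
noncomputable def sparseColor (b j₀ : ℕ) (nb : ℕ → Finset ℕ) (v : ℕ) : ℕ :=
  2 ^ ((b + 3) * guess b nb v) +
    iterSplit (2 ^ (b + 3)) j₀ b (guess b nb v) (classNbr b nb (guess b nb v)) v

theorem sparseColor_lt {N : Net} {n L b j₀ : ℕ} {nb : ℕ → Finset ℕ} (h : IsSub N n nb)
    (hL : n < 2 ^ L) (hb : 0 < b) (hj : 14 * 2 ^ (b + 3) ≤ fieldSize j₀) {v : ℕ} (hv : v < n) :
    sparseColor b j₀ nb v < 2 * 2 ^ ((b + 3) * guess b nb v) := by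
  have := iterSplit_lt (h.classNbr b (guess b nb v)) hL hj (h.sparse_classNbr hb _) hv
  unfold sparseColor
  omega

/-- Guess `i` uses the interval from `2 ^ ((b + 3) * i)` up to, but excluding, its double, which
ends before the interval of the next guess begins. -/
theorem sparseColor_lt_of_guess_lt {N : Net} {n L b j₀ : ℕ} {nb : ℕ → Finset ℕ}
    (h : IsSub N n nb) (hL : n < 2 ^ L) (hb : 0 < b) (hj : 14 * 2 ^ (b + 3) ≤ fieldSize j₀)
    {u v : ℕ} (hu : u < n) (huv : guess b nb u < guess b nb v) :
    sparseColor b j₀ nb u < sparseColor b j₀ nb v := by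
  refine (sparseColor_lt h hL hb hj hu).trans_le ?_
  unfold sparseColor
  refine le_trans ?_ (Nat.le_add_right _ _)
  rw [← pow_succ']
  refine Nat.pow_le_pow_right (by norm_num) ?_
  nlinarith

theorem sparseColor_ne {N : Net} {n L b j₀ : ℕ} {nb : ℕ → Finset ℕ} (h : IsSub N n nb)
    (hL : n < 2 ^ L) (hb : 0 < b) (hj : 14 * 2 ^ (b + 3) ≤ fieldSize j₀) {u v : ℕ}
    (hu : u ∈ nb v) : sparseColor b j₀ nb u ≠ sparseColor b j₀ nb v := by
  rcases lt_trichotomy (guess b nb u) (guess b nb v) with hlt | heq | hlt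
  · exact (sparseColor_lt_of_guess_lt h hL hb hj (h.lt v u hu) hlt).ne
  · unfold sparseColor
    rw [heq, Ne, Nat.add_left_cancel_iff]
    exact iterSplit_ne (h.classNbr b _) hL hj (h.sparse_classNbr hb _)
      (mem_filter.2 ⟨hu, heq, rfl⟩)
  · exact (sparseColor_lt_of_guess_lt h hL hb hj (h.lt u v (h.symm hu)) hlt).ne'

theorem det_sparseColor {N : Net} {n t L b j₀ I : ℕ} {nb : Net → ℕ → Finset ℕ}
    (h : IsSub N n (nb N)) (hdet : Det N n t nb) (hpos : 0 < n) (hL : n < 2 ^ L) (hb : 0 < b)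
    (hj : 14 * 2 ^ (b + 3) ≤ fieldSize j₀) (hI : ∀ v, guess b (nb N) v ≤ I) :
    Det N n (t + L + 1 + I * ((L + 1) * (fieldSize (j₀ + 1) + 3)))
      fun N => sparseColor b j₀ (nb N) := by
  intro N' v hv hag
  have hg : guess b (nb N) v = guess b (nb N') v :=
    det_guess h hdet hpos hL b N' v hv (hag.mono (by omega))
  have hle : guess b (nb N) v * ((L + 1) * (fieldSize (j₀ + 1) + 3)) ≤
      I * ((L + 1) * (fieldSize (j₀ + 1) + 3)) := Nat.mul_le_mul_right _ (hI v)
  have hc := det_iterSplit (j₀ := j₀) (h.classNbr b (guess b (nb N) v))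
    (det_classNbr h hdet hpos hL b (guess b (nb N) v)) hpos hL hj (h.sparse_classNbr hb _)
    N' v hv (hag.mono (by omega))
  simp only [sparseColor]
  rw [← hg]
  exact congrArg _ hc

/-! ### Greedy reduction of the small colors -/

/-- The greedy coloring in the order of increasing `χ`. -/
noncomputable def greedy (nb : ℕ → Finset ℕ) (χ : ℕ → ℕ) : ℕ → ℕ → ℕ
  | 0, _ => 0
  | f + 1, v => sInf {x | x ∉ image (greedy nb χ f) {u ∈ nb v | χ u < χ v}}

theorem sInf_notMem (S : Finset ℕ) : sInf {x | x ∉ S} ∉ S :=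
  Nat.sInf_mem (s := {x | x ∉ S}) (Infinite.exists_notMem_finset S)

theorem sInf_notMem_le_card (S : Finset ℕ) : sInf {x | x ∉ S} ≤ #S := by
  have h : range (sInf {x | x ∉ S}) ⊆ S := by
    intro x hx
    by_contra hxS
    exact (Nat.sInf_le (s := {x | x ∉ S}) hxS).not_gt (mem_range.1 hx)
  simpa using card_le_card h

theorem greedy_eq {nb : ℕ → Finset ℕ} {χ : ℕ → ℕ} {f f' v : ℕ} (hf : χ v < f) (hf' : χ v < f') :
    greedy nb χ f v = greedy nb χ f' v := by
  induction f generalizing f' v with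
  | zero => omega
  | succ f ih =>
    obtain ⟨f', rfl⟩ := Nat.exists_eq_succ_of_ne_zero (show f' ≠ 0 by omega)
    rw [greedy, Nat.succ_eq_add_one, greedy]
    have : image (greedy nb χ f) {u ∈ nb v | χ u < χ v} =
        image (greedy nb χ f') {u ∈ nb v | χ u < χ v} := by
      refine image_congr fun u hu => ?_
      have hu' := (mem_filter.1 (mem_coe.1 hu)).2
      exact ih (by omega) (by omega)
    rw [this]

theorem greedy_le_card (nb : ℕ → Finset ℕ) (χ : ℕ → ℕ) (f v : ℕ) :
    greedy nb χ f v ≤ #(nb v) := by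
  cases f with
  | zero => exact Nat.zero_le _
  | succ f => exact (sInf_notMem_le_card _).trans (card_image_le.trans (card_filter_le _ _))

/-- The color `χ v` is itself available, since by induction every relevant neighbor `u` received at
most `χ u < χ v`. -/
theorem greedy_le (nb : ℕ → Finset ℕ) (χ : ℕ → ℕ) (f v : ℕ) : greedy nb χ f v ≤ χ v := by
  induction f generalizing v with
  | zero => exact Nat.zero_le _
  | succ f ih =>
    refine Nat.sInf_le ?_
    simp only [Set.mem_ofPred_eq, mem_image, mem_filter, not_exists, not_and, and_imp]
    intro u _ hlt
    exact ((ih u).trans_lt hlt).ne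

theorem greedy_ne {nb : ℕ → Finset ℕ} {χ : ℕ → ℕ} {f u v : ℕ} (hu : u ∈ nb v) (hlt : χ u < χ v)
    (hf : χ v < f) : greedy nb χ f u ≠ greedy nb χ f v := by
  obtain ⟨f, rfl⟩ := Nat.exists_eq_succ_of_ne_zero (show f ≠ 0 by omega)
  intro heq
  have h := sInf_notMem (image (greedy nb χ f) {u ∈ nb v | χ u < χ v})
  apply h
  have h1 : greedy nb χ (f + 1) v = sInf {x | x ∉ image (greedy nb χ f) {u ∈ nb v | χ u < χ v}} :=
    rfl
  rw [← h1, ← Nat.succ_eq_add_one, ← heq, greedy_eq (f := f.succ) (f' := f) (by omega) (by omega)]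
  exact mem_image_of_mem _ (mem_filter.2 ⟨hu, hlt⟩)

theorem det_greedy {N : Net} {n t : ℕ} {nb : Net → ℕ → Finset ℕ} {χ : Net → ℕ → ℕ}
    (h : IsSub N n (nb N)) (hdet : Det N n t nb) (hχ : Det N n t χ) (f : ℕ) :
    Det N n (t + f) fun N => greedy (nb N) (χ N) f := by
  induction f with
  | zero => exact fun _ _ _ _ => rfl
  | succ f ih =>
    intro N' v hv hag
    have h1 := det_filter h hdet hχ (fun x y => x < y) N' v hv (hag.mono (by omega))
    simp only at h1
    simp only [greedy]
    rw [← h1]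
    have : image (greedy (nb N) (χ N) f) {u ∈ nb N v | χ N u < χ N v} =
        image (greedy (nb N') (χ N') f) {u ∈ nb N v | χ N u < χ N v} := by
      refine image_congr fun u hu => ?_
      have hu' := (mem_filter.1 (mem_coe.1 hu)).1
      exact ih N' u (h.lt v u hu') (hag.2 u (h.sub v hu'))
    rw [this]

/-- The colors below `m` are reduced greedily. -/
noncomputable def reduceSmall (m : ℕ) (nb : ℕ → Finset ℕ) (χ : ℕ → ℕ) (v : ℕ) : ℕ :=
  if χ v < m then greedy nb χ m v else χ v

theorem reduceSmall_le (m : ℕ) (nb : ℕ → Finset ℕ) (χ : ℕ → ℕ) (v : ℕ) :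
    reduceSmall m nb χ v ≤ χ v := by
  unfold reduceSmall
  split_ifs
  · exact greedy_le _ _ _ _
  · exact le_rfl

theorem reduceSmall_le_card {m : ℕ} {nb : ℕ → Finset ℕ} {χ : ℕ → ℕ} {v : ℕ} (h : χ v < m) :
    reduceSmall m nb χ v ≤ #(nb v) := by
  rw [reduceSmall, if_pos h]
  exact greedy_le_card _ _ _ _

/-- Greedy colors do not exceed the old ones, so reduced vertices remain below `m` and cannot clash
with the unchanged vertices at `m` or above. -/
theorem reduceSmall_ne {m : ℕ} {nb : ℕ → Finset ℕ} {χ : ℕ → ℕ} {u v : ℕ} (hu : u ∈ nb v)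
    (hv : v ∈ nb u) (hne : χ u ≠ χ v) : reduceSmall m nb χ u ≠ reduceSmall m nb χ v := by
  have hle := greedy_le nb χ m
  unfold reduceSmall
  split_ifs with h1 h2 h2
  · rcases hne.lt_or_gt with hlt | hlt
    · exact greedy_ne hu hlt h2
    · exact (greedy_ne hv hlt h1).symm
  · have := hle u
    omega
  · have := hle v
    omega
  · exact hne

theorem det_reduceSmall {N : Net} {n t : ℕ} {nb : Net → ℕ → Finset ℕ} {χ : Net → ℕ → ℕ}
    (h : IsSub N n (nb N)) (hdet : Det N n t nb) (hχ : Det N n t χ) (m : ℕ) :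
    Det N n (t + m) fun N => reduceSmall m (nb N) (χ N) := by
  intro N' v hv hag
  have h1 := hχ N' v hv (hag.mono (by omega))
  have h2 := det_greedy h hdet hχ m N' v hv hag
  simp only at h2
  simp only [reduceSmall]
  rw [h1, h2]

end Net

/-! ### From forests to sparsity. -/

namespace SimpleGraph

variable {V : Type*}

/-- Root every component. Endpoints of an edge differ by one in distance from the root, and paths in
a forest are unique, so a vertex has at most one neighbor nearer the root, which serves as its
parent. -/
theorem IsAcyclic.exists_parent {F : SimpleGraph V} (hF : F.IsAcyclic) :
    ∃ p : V → V, ∀ u v, F.Adj u v → p u = v ∨ p v = u := by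
  classical
  let R : V → V := fun v => (F.connectedComponentMk v).out
  have hR : ∀ v, F.Reachable (R v) v := fun v => ConnectedComponent.exact (Quot.out_eq _)
  have huniq : ∀ r u v w, F.Reachable r u → F.Adj u v → F.Adj u w →
      F.dist r u = F.dist r v + 1 → F.dist r u = F.dist r w + 1 → v = w := by
    intro r u v w hr hv hw hdv hdw
    obtain ⟨q, hq⟩ := (hr.trans hv.reachable).exists_walk_length_eq_dist
    obtain ⟨q', hq'⟩ := (hr.trans hw.reachable).exists_walk_length_eq_dist
    have h1 : (q.concat hv.symm).IsPath :=
      Walk.isPath_of_length_eq_dist _ (by rw [Walk.length_concat, hq, hdv])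
    have h2 : (q'.concat hw.symm).IsPath :=
      Walk.isPath_of_length_eq_dist _ (by rw [Walk.length_concat, hq', hdw])
    have h3 := (hF.subsingleton_path r u).elim ⟨_, h1⟩ ⟨_, h2⟩
    have h4 := congrArg (fun p : F.Path r u => (p : F.Walk r u).penultimate) h3
    simpa using h4
  refine ⟨fun v => if h : ∃ u, F.Adj v u ∧ F.dist (R v) v = F.dist (R v) u + 1 then h.choose
    else v, ?_⟩
  have key : ∀ u v, F.Adj u v → F.dist (R u) u = F.dist (R u) v + 1 →
      (if h : ∃ w, F.Adj u w ∧ F.dist (R u) u = F.dist (R u) w + 1 then h.choose else u) = v := by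
    intro u v huv hd
    have h : ∃ w, F.Adj u w ∧ F.dist (R u) u = F.dist (R u) w + 1 := ⟨v, huv, hd⟩
    rw [dif_pos h]
    exact huniq _ _ _ _ (hR u) h.choose_spec.1 huv h.choose_spec.2 hd
  intro u v huv
  have hRuv : R u = R v := by
    simp only [R]
    rw [ConnectedComponent.sound huv.reachable]
  rcases hF.dist_eq_dist_add_one_of_adj_of_reachable (R u) huv (hR u) with hd | hd
  · exact Or.inl (key u v huv hd)
  · rw [hRuv] at hd
    exact Or.inr (key v u huv.symm hd)

end SimpleGraph

open Finset in
theorem Net.sparse_ofGraph {V : Type*} [Fintype V] (G : SimpleGraph V) (ident : V → ℕ)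
    (hid : Function.Injective ident) :
    Net.Sparse (Net.ofGraph G ident hid).nbr G.arboricity := by
  classical
  obtain ⟨F, hF1, -, hF2⟩ := Nat.sInf_mem
    (s := {k : ℕ | ∃ F : Fin k → SimpleGraph V, G.IsForestDecomposition F})
    G.exists_isForestDecomposition
  change Fin G.arboricity → SimpleGraph V at F
  choose p hp using fun i => (hF1 i).exists_parent
  refine Net.Sparse.of_orientation (out := fun j => if h : ∃ v, ident v = j then
    univ.image fun i => ident (p i h.choose) else ∅) ?_ ?_
  · have hout : ∀ v i, ident (p i v) ∈ (if h : ∃ w, ident w = ident v then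
        univ.image fun i => ident (p i h.choose) else ∅ : Finset ℕ) := by
      intro v i
      have h : ∃ w, ident w = ident v := ⟨v, rfl⟩
      rw [dif_pos h, hid h.choose_spec]
      exact mem_image_of_mem _ (mem_univ i)
    intro j' j hj
    obtain ⟨u, v, rfl, rfl, huv⟩ := Net.mem_nbr_ofGraph.1 hj
    have he : s(v, u) ∈ ⋃ i, (F i).edgeSet := hF2 ▸ huv
    obtain ⟨i, hi⟩ := Set.mem_iUnion.1 he
    rcases hp i v u hi with h | h
    · left
      have := hout v i
      rwa [h] at this
    · right
      have := hout u i
      rwa [h] at this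
  · intro j
    split_ifs with h
    · refine card_image_le.trans ?_
      rw [card_univ, Fintype.card_fin]
      rfl
    · simp

/-! ### The final coloring and its locality. -/

namespace Net

open Finset

/-- The coloring that the algorithm computes. -/
noncomputable def finalColor (b j₀ m : ℕ) (N : Net) : ℕ → ℕ :=
  reduceSmall m N.nbr (sparseColor b j₀ N.nbr)

theorem det_finalColor {N : Net} {n L b j₀ I m : ℕ} (h : IsSub N n N.nbr) (hpos : 0 < n)
    (hL : n < 2 ^ L) (hb : 0 < b) (hj : 14 * 2 ^ (b + 3) ≤ fieldSize j₀)
    (hI : ∀ v, guess b N.nbr v ≤ I) :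
    Det N n ((I + 1) * ((L + 2) * (fieldSize (j₀ + 1) + m + 3))) (finalColor b j₀ m) := by
  have h1 := det_sparseColor (nb := Net.nbr) h (det_nbr N n) hpos hL hb hj hI
  refine (det_reduceSmall (nb := Net.nbr) h ((det_nbr N n).mono (by omega)) h1 m).mono ?_
  have hI' : I * ((L + 1) * (fieldSize (j₀ + 1) + 3)) ≤
      I * ((L + 2) * (fieldSize (j₀ + 1) + m + 3)) := by gcongr <;> omega
  have h2 : 1 + L + 1 + m ≤ (L + 2) * (fieldSize (j₀ + 1) + m + 3) := by nlinarith
  calc 1 + L + 1 + I * ((L + 1) * (fieldSize (j₀ + 1) + 3)) + m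
      = I * ((L + 1) * (fieldSize (j₀ + 1) + 3)) + (1 + L + 1 + m) := by ring
    _ ≤ I * ((L + 2) * (fieldSize (j₀ + 1) + m + 3)) +
        (L + 2) * (fieldSize (j₀ + 1) + m + 3) := Nat.add_le_add hI' h2
    _ = _ := by ring

end Net

/-! ### Numerical estimates and the theorem. -/

theorem exists_exponent (a : ℕ) {b : ℕ} (hb : 0 < b) :
    ∃ I, 4 * a < 2 ^ (b * I) ∧ (I = 0 ∨ 2 ^ (b * (I - 1)) ≤ 4 * a) := by
  classical
  have hex : ∃ I, 4 * a < 2 ^ (b * I) := by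
    refine ⟨4 * a, Nat.lt_two_pow_self.trans_le ?_⟩
    exact Nat.pow_le_pow_right (by norm_num) (Nat.le_mul_of_pos_left _ hb)
  refine ⟨Nat.find hex, Nat.find_spec hex, ?_⟩
  rcases Nat.eq_zero_or_pos (Nat.find hex) with h | h
  · exact Or.inl h
  · exact Or.inr (not_lt.1 (Nat.find_min hex (Nat.sub_lt h one_pos)))

theorem logb_two_natCast_nonneg (a : ℕ) : 0 ≤ Real.logb 2 a := by
  rcases Nat.eq_zero_or_pos a with rfl | h
  · simp
  · exact Real.logb_nonneg (by norm_num) (by exact_mod_cast h)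

theorem exponent_le {a b I : ℕ} (hb : 0 < b) (hI : I = 0 ∨ 2 ^ (b * (I - 1)) ≤ 4 * a) :
    (I : ℝ) ≤ 3 + Real.logb 2 a := by
  have hlog : 0 ≤ Real.logb 2 a := logb_two_natCast_nonneg a
  rcases hI with rfl | hI
  · norm_num
    linarith
  · have hpos : 0 < a := by
      have : 0 < 2 ^ (b * (I - 1)) := by positivity
      omega
    have h1 : (2 : ℝ) ^ (b * (I - 1)) ≤ 4 * a := by exact_mod_cast hI
    have h2 := Real.logb_le_logb_of_le one_lt_two (by positivity) h1
    have h4 : Real.logb 2 4 = 2 := by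
      rw [show (4 : ℝ) = 2 ^ 2 by norm_num, Real.logb_pow, Real.logb_self_eq_one one_lt_two]
      norm_num
    rw [Real.logb_pow, Real.logb_self_eq_one one_lt_two, mul_one,
      Real.logb_mul (by norm_num) (by positivity), h4] at h2
    have h3 : I ≤ b * (I - 1) + 1 := by
      have := Nat.le_mul_of_pos_left (I - 1) hb
      omega
    have h5 : (I : ℝ) ≤ (b * (I - 1) : ℕ) + 1 := by exact_mod_cast h3
    linarith

theorem two_pow_exponent_le {a b I : ℕ} (hI : I = 0 ∨ 2 ^ (b * (I - 1)) ≤ 4 * a) :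
    2 ^ (b * I) ≤ 2 ^ (b + 2) * (a + 1) := by
  rcases hI with rfl | hI
  · simp only [mul_zero, pow_zero]
    exact Nat.one_le_iff_ne_zero.2 (by positivity)
  · rcases Nat.eq_zero_or_pos I with rfl | hpos
    · simp only [mul_zero, pow_zero]
      exact Nat.one_le_iff_ne_zero.2 (by positivity)
    · obtain ⟨i, rfl⟩ := Nat.exists_eq_succ_of_ne_zero hpos.ne'
      rw [Nat.succ_sub_one] at hI
      calc 2 ^ (b * (i + 1)) = 2 ^ b * 2 ^ (b * i) := by rw [← pow_add]; ring_nf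
        _ ≤ 2 ^ b * (4 * a) := Nat.mul_le_mul_left _ hI
        _ = 2 ^ (b + 2) * a := by rw [pow_add]; ring
        _ ≤ _ := Nat.mul_le_mul_left _ (Nat.le_succ a)

theorem size_succ_le (n : ℕ) : (Nat.size (n + 1) : ℝ) ≤ 2 * (1 + Real.logb 2 n) := by
  rcases Nat.eq_zero_or_pos n with rfl | hpos
  · norm_num
  · set s := Nat.size (n + 1) with hs
    have hs0 : 0 < s := Nat.size_pos.2 (Nat.succ_pos n)
    have h1 : 2 ^ (s - 1) ≤ n + 1 := Nat.lt_size.1 (by omega)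
    have h2 : (2 : ℝ) ^ (s - 1) ≤ 2 * n := by
      have : 2 ^ (s - 1) ≤ 2 * n := by omega
      exact_mod_cast this
    have h3 := Real.logb_le_logb_of_le one_lt_two (by positivity) h2
    rw [Real.logb_pow, Real.logb_self_eq_one one_lt_two, mul_one,
      Real.logb_mul (by norm_num) (by positivity), Real.logb_self_eq_one one_lt_two,
      Nat.cast_sub hs0] at h3
    have := logb_two_natCast_nonneg n
    push_cast at h3
    linarith

theorem isLittleO_rpow_atTop_of_lt_one {θ : ℝ} (hθ : θ < 1) :
    (fun x : ℝ => x ^ θ) =o[atTop] (fun x : ℝ => x) := by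
  refine (isLittleO_iff_tendsto' ?_).2 ?_
  · filter_upwards [eventually_gt_atTop 0] with x hx h0
    exact absurd h0 hx.ne'
  · refine (tendsto_rpow_neg_atTop (sub_pos.2 hθ)).congr' ?_
    filter_upwards [eventually_gt_atTop 0] with x hx
    rw [neg_sub, Real.rpow_sub_one hx.ne']

/-- The size of the palette. -/
noncomputable def paletteSize (μ : ℝ) (b Δ : ℕ) : ℕ :=
  ⌈2 * ((2 : ℝ) ^ (b + 3) * ((Δ : ℝ) + 1) ^ (1 - μ)) ^ (((b : ℝ) + 3) / b)⌉₊

/-- Up to constants the palette is `Δ` to the power `(1 - μ) * (b + 3) / b`, and `b > 3 / μ` is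
enough to make this exponent less than 1. -/
theorem paletteSize_isLittleO {μ : ℝ} (hμ : 0 < μ) {b : ℕ} (hb : 3 / μ < b) :
    (fun Δ : ℕ => (paletteSize μ b Δ : ℝ)) =o[atTop] (fun Δ : ℕ => (Δ : ℝ)) := by
  have hb0 : (0 : ℝ) < b := lt_trans (by positivity) hb
  set κ : ℝ := ((b : ℝ) + 3) / b with hκ
  have hθ : (1 - μ) * κ < 1 := by
    rw [hκ, ← mul_div_assoc, div_lt_one hb0]
    rw [div_lt_iff₀ hμ] at hb
    nlinarith
  have hcast : Tendsto (fun Δ : ℕ => (Δ : ℝ)) atTop atTop := tendsto_natCast_atTop_atTop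
  have hone : (fun _ : ℕ => (1 : ℝ)) =o[atTop] (fun Δ : ℕ => (Δ : ℝ)) :=
    (isLittleO_const_id_atTop (1 : ℝ)).comp_tendsto hcast
  have hpow : (fun Δ : ℕ => ((Δ : ℝ) + 1) ^ ((1 - μ) * κ)) =o[atTop] (fun Δ : ℕ => (Δ : ℝ)) := by
    have h1 := (isLittleO_rpow_atTop_of_lt_one hθ).comp_tendsto
      (tendsto_atTop_add_const_right atTop (1 : ℝ) hcast)
    simp only [Function.comp_def] at h1
    exact h1.trans_isBigO ((isBigO_refl _ _).add hone.isBigO)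
  have hsum := (hpow.const_mul_left (2 * ((2 : ℝ) ^ (b + 3)) ^ κ)).add hone
  refine IsLittleO.of_bound fun c hc => ?_
  filter_upwards [hsum.bound hc] with Δ hΔ
  refine le_trans ?_ hΔ
  rw [Real.norm_natCast, Real.norm_of_nonneg (by positivity)]
  refine (Nat.ceil_lt_add_one (by positivity)).le.trans (le_of_eq ?_)
  rw [Real.mul_rpow (by positivity) (by positivity), ← Real.rpow_mul (by positivity)]
  ring

theorem le_paletteSize {μ : ℝ} {a b I Δ : ℕ} (hb : 0 < b)
    (hI : I = 0 ∨ 2 ^ (b * (I - 1)) ≤ 4 * a) (ha : (a : ℝ) ≤ ((Δ : ℝ) + 1) ^ (1 - μ))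
    (hμ1 : μ < 1) : 2 * 2 ^ ((b + 3) * I) ≤ paletteSize μ b Δ := by
  have hbR : (0 : ℝ) < b := by exact_mod_cast hb
  have h1 : (2 : ℝ) ^ (b * I) ≤ 2 ^ (b + 2) * (a + 1) := by
    exact_mod_cast two_pow_exponent_le hI
  have h2 : (1 : ℝ) ≤ ((Δ : ℝ) + 1) ^ (1 - μ) :=
    Real.one_le_rpow (by linarith [Nat.cast_nonneg (α := ℝ) Δ]) (by linarith)
  have h3 : (2 : ℝ) ^ (b * I) ≤ (2 : ℝ) ^ (b + 3) * ((Δ : ℝ) + 1) ^ (1 - μ) := by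
    refine h1.trans ?_
    rw [pow_succ (2 : ℝ) (b + 2), mul_assoc]
    gcongr
    linarith
  have h4 : (2 : ℝ) ^ ((b + 3) * I) = ((2 : ℝ) ^ (b * I)) ^ (((b : ℝ) + 3) / b) := by
    rw [← Real.rpow_natCast, ← Real.rpow_natCast, ← Real.rpow_mul (by norm_num)]
    congr 1
    push_cast
    field_simp
  have h5 : (2 * 2 ^ ((b + 3) * I) : ℝ) ≤ paletteSize μ b Δ := by
    refine le_trans ?_ (Nat.le_ceil _)
    rw [h4]
    gcongr
  exact_mod_cast h5

/-- Eventually `X Δ ≤ Δ`, so only finitely many `Δ` are concerned. The bound becomes the constant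
below which colors are reduced greedily. -/
theorem exists_bound_of_isLittleO {X : ℕ → ℕ}
    (h : (fun Δ : ℕ => (X Δ : ℝ)) =o[atTop] (fun Δ : ℕ => (Δ : ℝ))) :
    ∃ m, ∀ Δ, Δ + 1 ≤ X Δ → X Δ ≤ m := by
  have h1 := h.bound one_pos
  obtain ⟨D, hD⟩ := eventually_atTop.1 h1
  refine ⟨∑ Δ ∈ Finset.range D, X Δ, fun Δ hΔ => ?_⟩
  have hlt : Δ < D := by
    by_contra! hle
    have h2 := hD Δ hle
    simp only [Real.norm_natCast, one_mul, Nat.cast_le] at h2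
    omega
  exact Finset.single_le_sum (f := X) (fun _ _ => Nat.zero_le _) (Finset.mem_range.2 hlt)

theorem mainTheorem11 (ν : ℝ) (hν : 0 < ν) :
    ∃ (A : LocalAlgorithm) (C : ℝ) (g : ℕ → ℕ),
      (∀ Δ : ℕ, g Δ ≤ Δ + 1) ∧
      (fun Δ : ℕ => (g Δ : ℝ)) =o[atTop] (fun Δ : ℕ => (Δ : ℝ)) ∧
      ∀ (V : Type*) [Fintype V] (G : SimpleGraph V) [DecidableRel G.Adj] (ident : V → ℕ),
        IsIdentityAssignment ident →
        (G.arboricity : ℝ) ≤ (G.maxDegree : ℝ) ^ (1 - ν) →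
        ∃ T : ℕ,
          (T : ℝ) ≤ C * (1 + Real.logb 2 G.arboricity) * (1 + Real.logb 2 (Fintype.card V)) ∧
          A.ColorsWithin G ident T (g G.maxDegree) := by
  -- Capping the exponent at `1 / 2` keeps `1 - μ` positive when `ν ≥ 1`.
  set μ := min ν (1 / 2) with hμdef
  have hμ : 0 < μ := lt_min hν (by norm_num)
  have hμ1 : μ < 1 := (min_le_right _ _).trans_lt (by norm_num)
  obtain ⟨b, hb⟩ := exists_nat_gt (3 / μ)
  have hb0 : 0 < b := by
    have : (0 : ℝ) < b := lt_trans (by positivity) hb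
    exact_mod_cast this
  obtain ⟨j₀, hj⟩ : ∃ j₀, 14 * 2 ^ (b + 3) ≤ Net.fieldSize j₀ := by
    refine ⟨14 * 2 ^ (b + 3), ?_⟩
    unfold Net.fieldSize
    exact (Nat.lt_two_pow_self.le).trans Nat.lt_two_pow_self.le
  have hlittle := paletteSize_isLittleO hμ hb
  obtain ⟨m, hm⟩ := exists_bound_of_isLittleO hlittle
  refine ⟨LocalAlgorithm.ofDetermined (Net.finalColor b j₀ m),
    16 * ((Net.fieldSize (j₀ + 1) + m + 3 : ℕ) : ℝ), fun Δ => min (Δ + 1) (paletteSize μ b Δ),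
    fun Δ => min_le_left _ _, ?_, ?_⟩
  · refine IsLittleO.of_bound fun c hc => ?_
    filter_upwards [hlittle.bound hc] with Δ hΔ
    refine le_trans ?_ hΔ
    rw [Real.norm_natCast, Real.norm_natCast]
    exact_mod_cast min_le_right _ _
  intro V _ G _ ident hident harb
  set a := G.arboricity with ha
  set Δ := G.maxDegree with hΔ
  set N := Net.ofGraph G ident hident.1 with hN
  -- Identities start at 1 while networks are treated on the numbers below `n`, hence the extra one.
  set n := Fintype.card V + 1 with hn
  have hnpos : 0 < n := Nat.succ_pos _
  have hid : ∀ v, ident v < n := fun v => Nat.lt_succ_of_le (hident.2 v).2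
  have hsub : Net.IsSub N n N.nbr := by
    refine ⟨fun v => Finset.Subset.refl _, fun j i hi => ?_, N.symm⟩
    obtain ⟨u, v, rfl, rfl, -⟩ := Net.mem_nbr_ofGraph.1 hi
    exact hid u
  have hL : n < 2 ^ Nat.size n := Nat.lt_size_self n
  have hs : Net.Sparse N.nbr a := Net.sparse_ofGraph G ident hident.1
  obtain ⟨I, hI1, hI2⟩ := exists_exponent a hb0
  have hguess : ∀ v, Net.guess b N.nbr v ≤ I := Net.guess_le hsub hnpos hL hs hI1
  -- The base `Δ + 1` also covers `Δ = 0`, where `0 ^ (1 - ν)` equals 1 if `ν = 1`.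
  have ha' : (a : ℝ) ≤ ((Δ : ℝ) + 1) ^ (1 - μ) := by
    refine harb.trans ?_
    rcases Nat.eq_zero_or_pos Δ with h0 | hpos
    · rw [h0]
      simp only [Nat.cast_zero, zero_add, Real.one_rpow]
      exact Real.zero_rpow_le_one _
    · have h1 : (1 : ℝ) ≤ Δ := by exact_mod_cast hpos
      calc (Δ : ℝ) ^ (1 - ν) ≤ (Δ : ℝ) ^ (1 - μ) :=
            Real.rpow_le_rpow_of_exponent_le h1 (by linarith [min_le_left ν (1 / 2)])
        _ ≤ _ := Real.rpow_le_rpow (by positivity) (by linarith) (by linarith)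
  have hpal : ∀ v < n, Net.sparseColor b j₀ N.nbr v < paletteSize μ b Δ := by
    intro v hv
    refine (Net.sparseColor_lt hsub hL hb0 hj hv).trans_le
      (le_trans ?_ (le_paletteSize hb0 hI2 ha' hμ1))
    gcongr
    · norm_num
    · exact hguess v
  have hdeg : ∀ v, (N.nbr (ident v)).card ≤ Δ := by
    intro v
    refine le_trans ?_ (G.degree_le_maxDegree v)
    rw [← SimpleGraph.card_neighborFinset_eq_degree,
      ← Finset.card_image_of_injective _ hident.1]
    refine Finset.card_le_card fun j hj => ?_
    obtain ⟨u, v', rfl, hv', h⟩ := Net.mem_nbr_ofGraph.1 hj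
    obtain rfl := hident.1 hv'
    exact Finset.mem_image_of_mem _ ((G.mem_neighborFinset _ _).2 h)
  have hcol : ∀ v, Net.finalColor b j₀ m N (ident v) < min (Δ + 1) (paletteSize μ b Δ) := by
    intro v
    have h1 := hpal _ (hid v)
    have h2 := Net.reduceSmall_le m N.nbr (Net.sparseColor b j₀ N.nbr) (ident v)
    rw [lt_min_iff]
    refine ⟨?_, h2.trans_lt h1⟩
    rcases lt_or_ge (paletteSize μ b Δ) (Δ + 1) with hlt | hge
    · exact (h2.trans_lt h1).trans hlt
    -- Here the palette is at least `Δ + 1`, so by the choice of `m` every color is below `m` and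
    -- greedy reduction reaches all vertices.
    · have h3 := Net.reduceSmall_le_card (nb := N.nbr) (h1.trans_le (hm Δ hge))
      exact Nat.lt_succ_of_le (h3.trans (hdeg v))
  refine ⟨(I + 1) * ((Nat.size n + 2) * (Net.fieldSize (j₀ + 1) + m + 3)), ?_, ?_⟩
  · have h1 := exponent_le hb0 hI2
    have h2 := size_succ_le (Fintype.card V)
    have h3 : 0 ≤ Real.logb 2 a := logb_two_natCast_nonneg a
    have h4 : 0 ≤ Real.logb 2 (Fintype.card V) := logb_two_natCast_nonneg _
    rw [Nat.cast_mul, Nat.cast_mul]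
    set M : ℝ := ((Net.fieldSize (j₀ + 1) + m + 3 : ℕ) : ℝ) with hM
    have hM0 : 0 ≤ M := Nat.cast_nonneg _
    push_cast
    calc ((I : ℝ) + 1) * (((Nat.size n : ℕ) + 2) * M)
        ≤ (4 * (1 + Real.logb 2 a)) * ((4 * (1 + Real.logb 2 (Fintype.card V))) * M) := by
          gcongr
          · linarith
          · linarith
      _ = _ := by ring
  · refine ⟨SimpleGraph.Coloring.mk (fun v => ⟨_, hcol v⟩) ?_, fun v => ?_⟩
    · intro u v huv heq
      rw [Fin.mk.injEq] at heq
      have h1 : ident u ∈ N.nbr (ident v) := Net.ident_mem_nbr_ofGraph.2 huv.symm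
      exact Net.reduceSmall_ne h1 (N.symm h1) (Net.sparseColor_ne hsub hL hb0 hj h1) heq
    · exact LocalAlgorithm.output_ofDetermined _ G ident hident.1 _ hid
        (Net.det_finalColor hsub hnpos hL hb0 hj hguess) v
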